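/- **Setting.** Let $n\ge 3$ be the number of users, identified with $[n]=\{1,\dots,n\}$, and let $1\le t\le\lfloor n/2\rfloor$, $\epsilon\ge 0$, $\delta\in[0,1]$. User $i$ holds row $i$ of a matrix $\mathbf A=(a_{i,j})\in\{0,1\}^{n\times n}$; an undirected graph $G$ on $[n]$ is given to an algorithm as its adjacency matrix. For $x\in\{0,1\}$ let $\mathcal R_\epsilon(x)$ be randomized response, which returns $x$ with probability $\frac{e^\epsilon}{e^\epsilon+1}$ and $1-x$ otherwise. **Privacy.** A randomized algorithm $\mathcal M$ provides $(\epsilon,\delta)$-*element DP* if $\Pr[\mathcal M(\mathbf A)\in S]\le e^{\epsilon}\Pr[\mathcal M(\mathbf A')\in S]+\delta$ for every set $S$ of outputs and all matrices $\mathbf A,\mathbf A'\in\{0,1\}^{n\times n}$ (not necessarily symmetric) that differ in exactly one entry. It provides $(\epsilon,\delta)$-*edge DP* if the same inequality holds for the adjacency matrices of any two graphs on $[n]$ that differ in exactly one edge. **Local privacy budget.** Let $\epsilon_L\ge 0$ be a value returned by $\mathtt{LocalPrivacyBudget}(n,\epsilon,\delta)$. That is, with $m=n-2$, at least one of the following holds: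 1. (closed-form bound) $\delta>0$, $\epsilon_L\le\log\frac{m}{16\log(2/\delta)}$ and $$\epsilon=\log\left(1+\frac{e^{\epsilon_L}-1}{e^{\epsilon_L}+1}\left(\frac{8\sqrt{e^{\epsilon_L}\log(4/\delta)}}{\sqrt m}+\frac{8e^{\epsilon_L}}{m}\right)\right);$$ 2. (numerical bound) the laws of $(A+\Delta,\;C-A+1-\Delta)$ and $(A+1-\Delta,\;C-A+\Delta)$ are $(\epsilon,\delta)$-indistinguishable, i.e. $P(S)\le e^\epsilon Q(S)+\delta$ and $Q(S)\le e^\epsilon P(S)+\delta$ for all $S$, where $P$ and $Q$ denote the two laws, $C\sim\mathrm{Bin}(m-1,e^{-\epsilon_L})$, $A\sim\mathrm{Bin}(C,\frac12)$ given $C$, and $\Delta\sim\mathrm{Bernoulli}\big(\frac{e^{\epsilon_L}}{e^{\epsilon_L}+1}\big)$ is independent of $(A,C)$. **Algorithms.** $\textsf{WSLE}$ on a pair $(i,j)$, with $I_{-(i,j)}=[n]\setminus\{i,j\}$: every $k\in I_{-(i,j)}$ computes $y_k=\mathcal R_{\epsilon_L}(a_{k,i}a_{k,j})$; a uniformly random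 permutation $\pi$ of $I_{-(i,j)}$ is drawn and the data collector receives $(y_{\pi(k)})_{k\in I_{-(i,j)}}$, $z_i=\mathcal R_\epsilon(a_{i,j})$ and $z_j=\mathcal R_\epsilon(a_{j,i})$ (all randomness independent). With $q=\frac1{e^\epsilon+1}$ and $q_L=\frac1{e^{\epsilon_L}+1}$ it computes $$\hat f_{i,j}=\frac{(z_i+z_j-2q)\sum_{k\in I_{-(i,j)}}(y_{\pi(k)}-q_L)}{2(1-2q)(1-2q_L)}$$ (read as $0$ if the denominator is $0$). $\textsf{WShuffle}_\triangle$ draws a uniformly random permutation $\sigma$ of $[n]$, runs $\textsf{WSLE}$ independently on the $t$ disjoint pairs $(\sigma(1),\sigma(2)),\dots,(\sigma(2t-1),\sigma(2t))$, and returns $\hat f^\triangle=\frac{n(n-1)}{6t}\sum_{i=1,3,\dots,2t-1}\hat f_{\sigma(i),\sigma(i+1)}$. **Theorem.** $\textsf{WShuffle}_\triangle$ provides $(\epsilon,\delta)$-element DP and $(2\epsilon,2\delta)$-edge DP. Both hold for the returned estimate $\hat f^\triangle$ and also for the whole view of the data collector, i.e. $\sigma$ together with all messages received in the $t$ runs of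 $\textsf{WSLE}$. -/

import Mathlib

noncomputable section

namespace WedgeShuffle

/-! ### Finite probability -/

/-- The joint law of finitely many independent random variables, the `i`-th one with law `p i`. -/
def indep {ι : Type*} [Fintype ι] [DecidableEq ι] {α : ι → Type*} [∀ i, Fintype (α i)]
    (p : ∀ i, PMF (α i)) : PMF (∀ i, α i) :=
  PMF.ofFintype (fun f => ∏ i, p i (f i)) (by
    rw [← Fintype.prod_sum]
    refine Finset.prod_eq_one fun i _ => ?_
    rw [← tsum_fintype (L := .unconditional _)]
    exact (p i).tsum_coe)

/-- `true` with probability `p`, `false` with probability `1 - p`. -/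
def bern (p : ℝ) (hp : p ∈ Set.Icc (0 : ℝ) 1) : PMF Bool :=
  PMF.ofFintype (fun b => ENNReal.ofReal (if b then p else 1 - p)) (by
    have h1 : 0 ≤ 1 - p := sub_nonneg.2 hp.2
    simp [← ENNReal.ofReal_add hp.1 h1])

/-- The binomial distribution: the number of successes in `N` independent trials, each with
success probability `p`. -/
def binomial (N : ℕ) (p : ℝ) (hp : p ∈ Set.Icc (0 : ℝ) 1) : PMF ℕ :=
  (indep fun _ : Fin N => bern p hp).map
    fun b => (Finset.univ.filter fun i => b i = true).card

/-- Warner's randomized response with parameter `ε`. -/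
def rr (ε : ℝ) (x : Bool) : PMF Bool :=
  PMF.ofFintype
    (fun y => ENNReal.ofReal
      (if x = y then Real.exp ε / (Real.exp ε + 1) else 1 / (Real.exp ε + 1))) (by
    have h : (0 : ℝ) < Real.exp ε + 1 := by positivity
    have h1 : Real.exp ε / (Real.exp ε + 1) + 1 / (Real.exp ε + 1) = 1 := by
      rw [← add_div, div_self h.ne']
    have h2 : 1 / (Real.exp ε + 1) + Real.exp ε / (Real.exp ε + 1) = 1 := by
      rw [add_comm, h1]
    cases x <;> simp only [Fintype.sum_bool, Bool.false_eq_true, Bool.true_eq_false, if_true,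
      if_false] <;> rw [← ENNReal.ofReal_add (by positivity) (by positivity)] <;>
      simp [h1, h2, -one_div])

/-! ### Differential privacy -/

/-- `Pr[P ∈ S] ≤ e^ε Pr[Q ∈ S] + δ` for every set `S` of outcomes. -/
def DPLe {Ω : Type*} (ε δ : ℝ) (P Q : PMF Ω) : Prop :=
  ∀ S : Set Ω,
    P.toOuterMeasure S
      ≤ ENNReal.ofReal (Real.exp ε) * Q.toOuterMeasure S + ENNReal.ofReal δ

/-- Adjacency data of `n` users: row `i` is the neighbour list held by user `i`. It is not required
to be symmetric, so that a single bit can change. -/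
abbrev AdjMatrix (n : ℕ) := Fin n → Fin n → Bool

/-- The adjacency matrix of an undirected graph. -/
def adj {n : ℕ} (G : SimpleGraph (Fin n)) : AdjMatrix n := by
  classical exact fun i j => decide (G.Adj i j)

/-- `(ε, δ)`-element DP: neighbouring inputs are two matrices that differ in exactly one bit. -/
def ElementDP {n : ℕ} {Ω : Type*} (M : AdjMatrix n → PMF Ω) (ε δ : ℝ) : Prop :=
  ∀ A A' : AdjMatrix n, (∃! e : Fin n × Fin n, A e.1 e.2 ≠ A' e.1 e.2) →
    DPLe ε δ (M A) (M A')

/-- `(ε, δ)`-edge DP: neighbouring inputs are two graphs that differ in exactly one edge. -/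
def EdgeDP {n : ℕ} {Ω : Type*} (M : SimpleGraph (Fin n) → PMF Ω) (ε δ : ℝ) : Prop :=
  ∀ G G' : SimpleGraph (Fin n), (∃ e, symmDiff G.edgeSet G'.edgeSet = {e}) →
    DPLe ε δ (M G) (M G')

/-! ### The local privacy budget -/

/-- The closed-form amplification bound `f(m, ε_L, δ)` for `m` shuffled users. -/
def amplification (m : ℕ) (εL δ : ℝ) : ℝ :=
  Real.log (1 + (Real.exp εL - 1) / (Real.exp εL + 1) *
    (8 * √(Real.exp εL * Real.log (4 / δ)) / √(m : ℝ) + 8 * Real.exp εL / (m : ℝ)))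

/-- `ε` is the closed-form upper bound for `m` shuffled users, within its range of validity. -/
def ClosedFormBound (m : ℕ) (εL ε δ : ℝ) : Prop :=
  0 < δ ∧ εL ≤ Real.log ((m : ℝ) / (16 * Real.log (2 / δ))) ∧ ε = amplification m εL δ

/-- The pair of laws whose divergence the numerical upper bound for `m` users evaluates:
`C ∼ Bin(m - 1, e^{-ε_L})`, `A ∼ Bin(C, 1/2)`, an independent
`Δ ∼ Bernoulli(e^{ε_L} / (e^{ε_L} + 1))`, and the law of `(A + Δ, C - A + 1 - Δ)` for `x = true`,
that of `(A + 1 - Δ, C - A + Δ)` for `x = false`.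
Here `rr εL x` is the law of `Δ` when `x` is true and of `1 - Δ` when `x` is false. -/
def cloneLaw (m : ℕ) (εL : ℝ) (hεL : 0 ≤ εL) (x : Bool) : PMF (ℕ × ℕ) :=
  (binomial (m - 1) (Real.exp (-εL))
      ⟨(Real.exp_pos _).le, Real.exp_le_one_iff.2 (neg_nonpos.2 hεL)⟩).bind fun C =>
    (binomial C (1 / 2) ⟨by norm_num, by norm_num⟩).bind fun A =>
      (rr εL x).map fun b => if b then (A + 1, C - A) else (A, C - A + 1)

/-- `ε` is at least the numerical upper bound for `m` shuffled users: the two laws above are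
`(ε, δ)`-indistinguishable. -/
def NumericalBound (m : ℕ) (εL : ℝ) (hεL : 0 ≤ εL) (ε δ : ℝ) : Prop :=
  DPLe ε δ (cloneLaw m εL hεL true) (cloneLaw m εL hεL false) ∧
    DPLe ε δ (cloneLaw m εL hεL false) (cloneLaw m εL hεL true)

/-- `εL` is an admissible return value of `LocalPrivacyBudget(n, ε, δ)`: in the shuffle model with
`n - 2 ≥ 1` users, `ε` is a closed-form or a numerical upper bound for `εL`. -/
def IsLocalPrivacyBudget (n : ℕ) (ε δ εL : ℝ) : Prop :=
  3 ≤ n ∧ ∃ hεL : 0 ≤ εL, ClosedFormBound (n - 2) εL ε δ ∨ NumericalBound (n - 2) εL hεL ε δ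

/-! ### The algorithms -/

/-- The set of users other than `i` and `j`. -/
abbrev Others {n : ℕ} (i j : Fin n) := {k : Fin n // k ≠ i ∧ k ≠ j}

/-- Wedge shuffling for the pair `(i, j)`: every other user `k` randomizes the wedge indicator
`a_{k,i} a_{k,j}`, and the noisy bits are permuted by a uniformly random permutation. -/
def ws {n : ℕ} (A : AdjMatrix n) (εL : ℝ) (i j : Fin n) : PMF (Others i j → Bool) :=
  (indep fun k : Others i j => rr εL (A k i && A k j)).bind fun y =>
    (PMF.uniformOfFintype (Equiv.Perm (Others i j))).map fun π k => y (π k)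

/-- What the data collector receives in one run of `WSLE` on the pair `(i, j)`: the shuffled noisy
wedge indicators and the two noisy edge indicators `z_i`, `z_j`. -/
abbrev Message {n : ℕ} (i j : Fin n) := (Others i j → Bool) × Bool × Bool

/-- The messages sent in `WSLE` (wedge shuffling with local edges). -/
def wsleMessage {n : ℕ} (A : AdjMatrix n) (ε εL : ℝ) (i j : Fin n) : PMF (Message i j) :=
  (ws A εL i j).bind fun y =>
    (rr ε (A i j)).bind fun zi =>
      (rr ε (A j i)).map fun zj => (y, zi, zj)

/-- A bit as a real number. -/
def bit (b : Bool) : ℝ := if b then 1 else 0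

/-- The estimate computed by `WSLE` from the received messages. -/
def wsleEstimate {n : ℕ} (ε εL : ℝ) (i j : Fin n) (o : Message i j) : ℝ :=
  let qL : ℝ := 1 / (Real.exp εL + 1)
  let q : ℝ := 1 / (Real.exp ε + 1)
  (bit o.2.1 + bit o.2.2 - 2 * q) * (∑ k, (bit (o.1 k) - qL)) /
    (2 * (1 - 2 * q) * (1 - 2 * qL))

/-- First user `σ(2s + 1)` of the pair number `s = 0, …, t - 1` (one-based indices). -/
def fstUser {n t : ℕ} (ht : t ≤ n / 2) (σ : Equiv.Perm (Fin n)) (s : Fin t) : Fin n :=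
  σ ⟨2 * s, by have := s.isLt; omega⟩

/-- Second user `σ(2s + 2)` of the pair number `s = 0, …, t - 1` (one-based indices). -/
def sndUser {n t : ℕ} (ht : t ≤ n / 2) (σ : Equiv.Perm (Fin n)) (s : Fin t) : Fin n :=
  σ ⟨2 * s + 1, by have := s.isLt; omega⟩

/-- All that the data collector sees: the permutation `σ`, and the messages of `WSLE` for each of
the `t` disjoint pairs. -/
abbrev View (n t : ℕ) (ht : t ≤ n / 2) :=
  Σ σ : Equiv.Perm (Fin n), ∀ s : Fin t, Message (fstUser ht σ s) (sndUser ht σ s)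

/-- The data collector's view in `WShuffle_△`: a uniformly random permutation `σ`, then independent
runs of `WSLE` on the `t` disjoint pairs that it determines. -/
def wShuffleView {n t : ℕ} (ht : t ≤ n / 2) (ε εL : ℝ) (A : AdjMatrix n) : PMF (View n t ht) :=
  (PMF.uniformOfFintype (Equiv.Perm (Fin n))).bind fun σ =>
    (indep fun s : Fin t => wsleMessage A ε εL (fstUser ht σ s) (sndUser ht σ s)).map
      fun o => (⟨σ, o⟩ : View n t ht)

/-- The estimate of the triangle count computed from the view. -/
def triangleEstimate {n t : ℕ} (ht : t ≤ n / 2) (ε εL : ℝ) (v : View n t ht) : ℝ :=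
  (n : ℝ) * ((n : ℝ) - 1) / (6 * (t : ℝ)) * ∑ s, wsleEstimate ε εL _ _ (v.2 s)

/-- `WShuffle_△`: the law of the returned estimate of the triangle count. -/
def wShuffle {n t : ℕ} (ht : t ≤ n / 2) (ε εL : ℝ) (A : AdjMatrix n) : PMF ℝ :=
  (wShuffleView ht ε εL A).map (triangleEstimate ht ε εL)

end WedgeShuffle

end

open WedgeShuffle

/-!
Why wedge shuffling is private. An event-wise privacy inequality is equivalent to the same
inequality for expectations of `[0, 1]`-valued test functions (`DPLe.expect_le`,
`DPLe.of_expect`), and the argument is carried out with expectations throughout.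

**One shuffle.** After shuffling, only the number of `true` reports matters. Randomized response
with parameter `ε_L` ignores its input and returns a fair coin with probability `e^{-ε_L}`
(`rr_eq_bind`). Let `C` of the users other than a distinguished one return a fair coin, `A` of these
coins showing `true`. Given `C`, the set of these users and the reports of the remaining ones are
independent of the coins and of the distinguished user, so the number of `true` reports is obtained
from `(A + d, C - A + 1 - d)` by a fixed kernel, where `d` is the report of the distinguished user
(`exists_clone_kernel`). The law of this pair is the clone law for that user's input.
Hence changing one input of the shuffle is at most as visible as exchanging the two clone laws,
which is the numerical bound (`expect_rr_le_of_numericalBound`).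

**The closed form.** Write `e = e^{ε_L}`. At a point `(a, b)` the ratio of the clone laws is
`(e a + b) / (a + e b)`, since adjacent binomial coefficients are in the ratio `a : b`. It is at
most `1 + (e - 1) / (e + 1) * X` unless `a - b` exceeds `X / (2 + X) * (a + b)`
(`expect_cloneLaw_le_mul`). That exceptional event has probability at most
`2 exp (-(m e⁻¹ (1 - exp (-τ² / 2))))` for `0 ≤ τ ≤ X / (2 + X)`, by the exponential Markov
inequality with exponent `τ (a - b)`, then the exact generating function of the binomial variable
`C` (`expect_cloneLaw_tail_le`). For the `X` of the closed-form bound this is at most `δ`, with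
`τ = 4 v / (1 + 4 v)` and `v² = e log (4 / δ) / m`; the condition on `ε_L` says that `v² ≤ 1 / 8`.
The other direction of indistinguishability follows by exchanging `a` and `b`.

**Composition.** For fixed `σ` the runs are independent, so their losses add up (`DPLe.indep`).
A run reads only the columns of its two users, and the pairs are disjoint. Changing the bit `(a, b)`
therefore affects at most the run whose pair contains `b`, and there either a noisy edge indicator
or one wedge indicator (`dpLe_wsleMessage_element`). An edge `{a, b}` amounts to two bits. If they
are read by two different runs, both losses are `(ε, δ)`; if `a` and `b` form a pair, then two noisy
edge indicators change, at a loss of `(2 ε, 0)` (`dpLe_wsleMessage_edge`). The estimate is a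
function of the view.
-/

namespace WedgeShuffle

open scoped ENNReal

/-! ### Expectations of nonnegative functions -/

/-- The expectation of a `[0, ∞]`-valued function under a probability mass function. -/
noncomputable def expect {Ω : Type*} (P : PMF Ω) (f : Ω → ℝ≥0∞) : ℝ≥0∞ := ∑' ω, P ω * f ω

section Expect

variable {Ω Ω' : Type*}

theorem expect_bind (P : PMF Ω) (K : Ω → PMF Ω') (f : Ω' → ℝ≥0∞) :
    expect (P.bind K) f = expect P fun a => expect (K a) f := by
  simp only [expect, PMF.bind_apply, ← ENNReal.tsum_mul_right, ← ENNReal.tsum_mul_left]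
  rw [ENNReal.tsum_comm]
  simp only [mul_assoc]

theorem expect_pure (a : Ω) (f : Ω → ℝ≥0∞) : expect (PMF.pure a) f = f a := by
  rw [expect, tsum_eq_single a]
  · simp
  · intro b hb
    simp [hb]

theorem expect_map (P : PMF Ω) (φ : Ω → Ω') (f : Ω' → ℝ≥0∞) :
    expect (P.map φ) f = expect P fun a => f (φ a) := by
  rw [← PMF.bind_pure_comp, expect_bind]
  simp only [Function.comp_apply, expect_pure]

theorem expect_mono (P : PMF Ω) {f g : Ω → ℝ≥0∞} (h : ∀ ω, f ω ≤ g ω) :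
    expect P f ≤ expect P g :=
  ENNReal.tsum_le_tsum fun ω => mul_le_mul_right (h ω) _

theorem expect_add (P : PMF Ω) (f g : Ω → ℝ≥0∞) :
    expect P (fun ω => f ω + g ω) = expect P f + expect P g := by
  simp only [expect, mul_add, ENNReal.tsum_add]

theorem expect_const_mul (P : PMF Ω) (c : ℝ≥0∞) (f : Ω → ℝ≥0∞) :
    expect P (fun ω => c * f ω) = c * expect P f := by
  simp only [expect, ← ENNReal.tsum_mul_left, mul_left_comm]

theorem expect_const (P : PMF Ω) (c : ℝ≥0∞) : expect P (fun _ => c) = c := by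
  simp only [expect, ENNReal.tsum_mul_right, P.tsum_coe, one_mul]

theorem expect_le_one (P : PMF Ω) {f : Ω → ℝ≥0∞} (h : ∀ ω, f ω ≤ 1) : expect P f ≤ 1 :=
  (expect_mono P h).trans_eq (expect_const P 1)

theorem expect_comm (P : PMF Ω) (Q : PMF Ω') (f : Ω → Ω' → ℝ≥0∞) :
    expect P (fun a => expect Q (f a)) = expect Q fun b => expect P fun a => f a b := by
  simp only [expect, ← ENNReal.tsum_mul_left]
  rw [ENNReal.tsum_comm]
  simp only [mul_left_comm]

theorem toOuterMeasure_eq_expect (P : PMF Ω) (S : Set Ω) :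
    P.toOuterMeasure S = expect P (S.indicator 1) := by
  classical
  rw [PMF.toOuterMeasure_apply, expect]
  refine tsum_congr fun ω => ?_
  by_cases h : ω ∈ S <;> simp [h]

theorem expect_fintype [Fintype Ω] (P : PMF Ω) (f : Ω → ℝ≥0∞) :
    expect P f = ∑ ω, P ω * f ω := by
  rw [expect, tsum_fintype]

/-- The conditional expectation of `f` given that `φ` takes the value `c`. On values `c` of
probability zero it is `0 / 0 = 0`. -/
noncomputable def condExpect (P : PMF Ω) (φ : Ω → Ω') (f : Ω → ℝ≥0∞) (c : Ω') : ℝ≥0∞ :=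
  expect P ((φ ⁻¹' {c}).indicator f) / P.map φ c

theorem map_apply_eq_expect (P : PMF Ω) (φ : Ω → Ω') (c : Ω') :
    P.map φ c = expect P ((φ ⁻¹' {c}).indicator 1) := by
  classical
  rw [PMF.map_apply, expect]
  refine tsum_congr fun ω => ?_
  by_cases h : c = φ ω
  · simp [h]
  · simp [h, Ne.symm h]

theorem expect_indicator_le (P : PMF Ω) (φ : Ω → Ω') {f : Ω → ℝ≥0∞} (hf : ∀ ω, f ω ≤ 1) (c : Ω') :
    expect P ((φ ⁻¹' {c}).indicator f) ≤ P.map φ c := by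
  rw [map_apply_eq_expect]
  exact expect_mono P fun ω => Set.indicator_le_indicator (hf ω)

theorem condExpect_le_one (P : PMF Ω) (φ : Ω → Ω') {f : Ω → ℝ≥0∞} (hf : ∀ ω, f ω ≤ 1) (c : Ω') :
    condExpect P φ f c ≤ 1 :=
  ENNReal.div_le_of_le_mul (by rw [one_mul]; exact expect_indicator_le P φ hf c)

theorem expect_mul_condExpect (P : PMF Ω) (φ : Ω → Ω') {f : Ω → ℝ≥0∞} (hf : ∀ ω, f ω ≤ 1)
    (h : Ω' → ℝ≥0∞) :
    expect P (fun ω => h (φ ω) * f ω) = expect (P.map φ) fun c => h c * condExpect P φ f c := by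
  classical
  have key : ∀ c, P.map φ c * condExpect P φ f c = expect P ((φ ⁻¹' {c}).indicator f) := by
    intro c
    refine ENNReal.mul_div_cancel' (fun h0 => ?_) (fun ht => ?_)
    · exact le_antisymm (h0 ▸ expect_indicator_le P φ hf c) zero_le
    · exact absurd ht ((P.map φ).apply_ne_top c)
  have h1 : ∀ c, P.map φ c * (h c * condExpect P φ f c)
      = ∑' ω, P ω * (if φ ω = c then h c * f ω else 0) := by
    intro c
    rw [mul_left_comm, key, expect, ← ENNReal.tsum_mul_left]
    refine tsum_congr fun ω => ?_
    by_cases hc : φ ω = c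
    · simp [hc, mul_left_comm]
    · simp [hc]
  rw [expect, expect, tsum_congr h1, ENNReal.tsum_comm]
  refine tsum_congr fun ω => ?_
  rw [ENNReal.tsum_mul_left, tsum_eq_single (φ ω)]
  · simp
  · intro c hc
    simp [hc.symm]

/-- Conditioning on `φ` under the expectation, when a further variable is sampled from a law that
depends on the outcome only through `φ`. -/
theorem expect_expect_condExpect {Λ : Type*} (P : PMF Ω) (φ : Ω → Ω') (K : Ω' → PMF Λ)
    {f : Λ → Ω → ℝ≥0∞} (hf : ∀ a ω, f a ω ≤ 1) :
    (expect P fun ω => expect (K (φ ω)) fun a => f a ω)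
      = expect (P.map φ) fun c => expect (K c) fun a => condExpect P φ (f a) c := by
  have h1 : ∀ (R : PMF Ω) (F : Λ → Ω → ℝ≥0∞),
      (expect R fun ω => ∑' a, F a ω) = ∑' a, expect R (F a) := by
    intro R F
    simp only [expect, ← ENNReal.tsum_mul_left]
    exact ENNReal.tsum_comm
  have h2 : ∀ (R : PMF Ω') (F : Λ → Ω' → ℝ≥0∞),
      (expect R fun ω => ∑' a, F a ω) = ∑' a, expect R (F a) := by
    intro R F
    simp only [expect, ← ENNReal.tsum_mul_left]
    exact ENNReal.tsum_comm
  change (expect P fun ω => ∑' a, K (φ ω) a * f a ω)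
    = expect (P.map φ) fun c => ∑' a, K c a * condExpect P φ (f a) c
  rw [h1, h2]
  exact tsum_congr fun a => expect_mul_condExpect P φ (hf a) fun c => K c a

end Expect

/-! ### Independent families -/

section Indep

variable {ι κ : Type*} [Fintype ι] [DecidableEq ι] [Fintype κ] [DecidableEq κ]

theorem indep_apply {α : ι → Type*} [∀ i, Fintype (α i)] (p : ∀ i, PMF (α i)) (f : ∀ i, α i) :
    indep p f = ∏ i, p i (f i) := rfl

theorem expect_indep_prod {α : ι → Type*} [∀ i, Fintype (α i)] (p : ∀ i, PMF (α i))
    (g : ∀ i, α i → ℝ≥0∞) :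
    expect (indep p) (fun f => ∏ i, g i (f i)) = ∏ i, expect (p i) (g i) := by
  simp only [expect_fintype, indep_apply, ← Finset.prod_mul_distrib]
  rw [Fintype.prod_sum fun i a => p i a * g i a]

/-- Fubini: one coordinate of an independent family can be sampled separately from the others. -/
theorem expect_indep_split {α : ι → Type*} [∀ i, Fintype (α i)] (p : ∀ i, PMF (α i)) (i₀ : ι)
    (f : (∀ i, α i) → ℝ≥0∞) :
    expect (indep p) f = expect (indep fun j : {j // j ≠ i₀} => p j) fun r =>
      expect (p i₀) fun a => f ((Equiv.piSplitAt i₀ α).symm (a, r)) := by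
  simp only [expect_fintype, Finset.mul_sum]
  rw [← (Equiv.piSplitAt i₀ α).symm.sum_comp, Fintype.sum_prod_type, Finset.sum_comm]
  refine Finset.sum_congr rfl fun r _ => Finset.sum_congr rfl fun a _ => ?_
  rw [← mul_assoc, mul_comm (indep _ r)]
  congr 1
  rw [indep_apply, indep_apply, Fintype.prod_eq_mul_prod_subtype_ne _ i₀]
  congr 1
  · simp
  · refine Finset.prod_congr rfl fun j _ => ?_
    simp [j.2]

theorem expect_indep_bind {α β : ι → Type*} [∀ i, Fintype (α i)] [∀ i, Fintype (β i)]
    (p : ∀ i, PMF (α i)) (K : ∀ i, α i → PMF (β i)) (f : (∀ i, β i) → ℝ≥0∞) :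
    expect (indep fun i => (p i).bind (K i)) f
      = expect (indep p) fun a => expect (indep fun i => K i (a i)) f := by
  rw [← expect_bind]
  congr 1
  ext b
  simp only [indep_apply, PMF.bind_apply, tsum_fintype]
  rw [Fintype.prod_sum]
  simp only [Finset.prod_mul_distrib]

/-- The marginal of an independent family along an injective reindexing. -/
theorem expect_indep_comp {α : Type*} [Fintype α] (p : ι → PMF α) {e : κ → ι}
    (he : Function.Injective e) (f : (κ → α) → ℝ≥0∞) :
    expect (indep p) (fun y => f fun k => y (e k)) = expect (indep fun k => p (e k)) f := by
  classical
  rw [← expect_map (indep p) (fun y k => y (e k))]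
  congr 1
  ext z
  rw [map_apply_eq_expect]
  have h1 : ((fun (y : ι → α) (k : κ) => y (e k)) ⁻¹' {z}).indicator (1 : (ι → α) → ℝ≥0∞)
      = fun y => ∏ i, ∏ k with e k = i, if y i = z k then 1 else 0 := by
    ext y
    rw [Finset.prod_comm' (t' := Finset.univ) (s' := fun k => {e k}) (by simp; tauto)]
    simp only [Finset.prod_singleton]
    simp only [Finset.prod_boole, Set.indicator_apply, Set.mem_preimage,
      Set.mem_singleton_iff, funext_iff, Finset.mem_univ, true_implies, Pi.one_apply]
  rw [h1, expect_indep_prod p fun i a => ∏ k with e k = i, if a = z k then 1 else 0, indep_apply]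
  have h2 : ∀ k, expect (p (e k)) (fun a => ∏ k' with e k' = e k, if a = z k' then 1 else 0)
      = p (e k) (z k) := by
    intro k
    have : (Finset.univ.filter fun k' => e k' = e k) = {k} := by
      ext k'
      simp [he.eq_iff]
    simp [this, expect_fintype]
  simp only [← h2]
  symm
  refine Fintype.prod_of_injective e he _ _ (fun i hi => ?_) fun k => rfl
  have : (Finset.univ.filter fun k => e k = i) = ∅ := by
    ext k
    simpa using fun h => hi ⟨k, h⟩
  simp [this, expect_const]

theorem expect_indep_map {α β : ι → Type*} [∀ i, Fintype (α i)] [∀ i, Fintype (β i)]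
    (p : ∀ i, PMF (α i)) (φ : ∀ i, α i → β i) (f : (∀ i, β i) → ℝ≥0∞) :
    expect (indep fun i => (p i).map (φ i)) f = expect (indep p) fun a => f fun i => φ i (a i) := by
  classical
  simp only [← PMF.bind_pure_comp]
  rw [expect_indep_bind]
  congr 1
  funext a
  have : indep (fun i => (PMF.pure ∘ φ i) (a i)) = PMF.pure fun i => φ i (a i) := by
    ext b
    simp [indep_apply, PMF.pure_apply, Finset.prod_boole, funext_iff]
  rw [this, expect_pure]

end Indep

/-! ### Differential privacy of elementary constructions -/

section DP

variable {Ω Ω' : Type*} {ε δ : ℝ} {P Q : PMF Ω}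

/-- The privacy inequality for events extends to `[0, 1]`-valued test functions: it suffices to
know it for the event on which `P` exceeds `e^ε Q`. -/
theorem DPLe.expect_le (h : DPLe ε δ P Q) {f : Ω → ℝ≥0∞} (hf : ∀ ω, f ω ≤ 1) :
    expect P f ≤ ENNReal.ofReal (Real.exp ε) * expect Q f + ENNReal.ofReal δ := by
  set E := ENNReal.ofReal (Real.exp ε) with hE
  set S : Set Ω := {ω | E * Q ω < P ω} with hS
  have hexc : ∑' ω, S.indicator (fun ω => P ω - E * Q ω) ω ≤ ENNReal.ofReal δ := by
    have h1 : (∑' ω, S.indicator (fun ω => P ω - E * Q ω) ω) + E * Q.toOuterMeasure S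
        = P.toOuterMeasure S := by
      rw [PMF.toOuterMeasure_apply, PMF.toOuterMeasure_apply, ← ENNReal.tsum_mul_left,
        ← ENNReal.tsum_add]
      refine tsum_congr fun ω => ?_
      by_cases hω : ω ∈ S
      · simp only [Set.indicator_of_mem hω]
        exact tsub_add_cancel_of_le (le_of_lt hω)
      · simp [Set.indicator_of_notMem hω]
    have h2 := h S
    rw [← h1, add_comm] at h2
    refine (ENNReal.add_le_add_iff_left ?_).1 h2
    have h3 : Q.toOuterMeasure S ≤ 1 := by
      rw [toOuterMeasure_eq_expect]
      exact expect_le_one Q fun ω => Set.indicator_le_self' (by simp) ω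
    exact ENNReal.mul_ne_top ENNReal.ofReal_ne_top (ne_top_of_le_ne_top ENNReal.one_ne_top h3)
  calc expect P f ≤ ∑' ω, (E * (Q ω * f ω) + S.indicator (fun ω => P ω - E * Q ω) ω) := by
        refine ENNReal.tsum_le_tsum fun ω => ?_
        by_cases hω : ω ∈ S
        · rw [Set.indicator_of_mem hω]
          calc P ω * f ω = (E * Q ω + (P ω - E * Q ω)) * f ω := by
                rw [add_tsub_cancel_of_le (le_of_lt hω)]
            _ = E * (Q ω * f ω) + (P ω - E * Q ω) * f ω := by rw [add_mul, mul_assoc]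
            _ ≤ _ := by
                gcongr
                exact mul_le_of_le_one_right' (hf ω)
        · rw [Set.indicator_of_notMem hω, add_zero, ← mul_assoc]
          gcongr
          exact not_lt.1 hω
    _ = E * expect Q f + ∑' ω, S.indicator (fun ω => P ω - E * Q ω) ω := by
        rw [ENNReal.tsum_add, ENNReal.tsum_mul_left, expect]
    _ ≤ _ := by gcongr

theorem DPLe.of_expect (h : ∀ f : Ω → ℝ≥0∞, (∀ ω, f ω ≤ 1) →
    expect P f ≤ ENNReal.ofReal (Real.exp ε) * expect Q f + ENNReal.ofReal δ) : DPLe ε δ P Q := by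
  intro S
  rw [toOuterMeasure_eq_expect, toOuterMeasure_eq_expect]
  exact h _ fun ω => Set.indicator_le_self' (by simp) ω

theorem DPLe.mono (h : DPLe ε δ P Q) {ε' δ' : ℝ} (hε : ε ≤ ε') (hδ : δ ≤ δ') : DPLe ε' δ' P Q :=
  fun S => (h S).trans (by gcongr)

theorem DPLe.refl (P : PMF Ω) : DPLe 0 0 P P := fun S => by simp

theorem DPLe.map (h : DPLe ε δ P Q) (φ : Ω → Ω') : DPLe ε δ (P.map φ) (Q.map φ) :=
  .of_expect fun f hf => by
    rw [expect_map, expect_map]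
    exact h.expect_le fun _ => hf _

theorem DPLe.bind_right (h : DPLe ε δ P Q) (K : Ω → PMF Ω') : DPLe ε δ (P.bind K) (Q.bind K) :=
  .of_expect fun f hf => by
    rw [expect_bind, expect_bind]
    exact h.expect_le fun _ => expect_le_one _ hf

theorem DPLe.bind_left (P : PMF Ω) {K L : Ω → PMF Ω'} (h : ∀ ω, DPLe ε δ (K ω) (L ω)) :
    DPLe ε δ (P.bind K) (P.bind L) :=
  .of_expect fun f hf => by
    rw [expect_bind, expect_bind, ← expect_const P (ENNReal.ofReal δ), ← expect_const_mul,
      ← expect_add]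
    exact expect_mono P fun ω => (h ω).expect_le hf

theorem DPLe.trans_pure {R : PMF Ω} {ε' : ℝ} (h : DPLe ε 0 P Q) (h' : DPLe ε' 0 Q R) :
    DPLe (ε + ε') 0 P R := by
  intro S
  have h1 := h S
  have h2 := h' S
  simp only [ENNReal.ofReal_zero, add_zero] at h1 h2 ⊢
  rw [Real.exp_add, ENNReal.ofReal_mul (Real.exp_pos _).le, mul_assoc]
  exact h1.trans (by gcongr)

end DP

section Composition

variable {ι : Type*} [Fintype ι] [DecidableEq ι] {α : ι → Type*} [∀ i, Fintype (α i)]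

/-- Exchanging one component of an independent family. Truncating `e^ε₁ g'` at `1` before the other
components are exchanged is what makes the additive errors add up without a factor `e^ε`. -/
theorem DPLe.indep_update {p p' : ∀ i, PMF (α i)} (i₀ : ι) {ε₁ δ₁ ε₂ δ₂ : ℝ}
    (hδ₁ : 0 ≤ δ₁) (hδ₂ : 0 ≤ δ₂) (h₁ : DPLe ε₁ δ₁ (p i₀) (p' i₀))
    (h₂ : DPLe ε₂ δ₂ (indep (Function.update p i₀ (p' i₀))) (indep p')) :
    DPLe (ε₁ + ε₂) (δ₁ + δ₂) (indep p) (indep p') := by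
  refine .of_expect fun f hf => ?_
  set E₁ := ENNReal.ofReal (Real.exp ε₁)
  set E₂ := ENNReal.ofReal (Real.exp ε₂)
  set join := fun (r : ∀ j : {j // j ≠ i₀}, α j) (a : α i₀) => (Equiv.piSplitAt i₀ α).symm (a, r)
  set g' := fun r => expect (p' i₀) fun a => f (join r a)
  set h := fun r => min 1 (E₁ * g' r)
  have step₁ : expect (indep p) f
      ≤ expect (indep fun j : {j // j ≠ i₀} => p j) h + ENNReal.ofReal δ₁ := by
    rw [expect_indep_split p i₀,
      ← expect_const (indep fun j : {j // j ≠ i₀} => p j) (ENNReal.ofReal δ₁), ← expect_add]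
    refine expect_mono _ fun r => ?_
    rw [min_add]
    exact le_min ((expect_le_one _ fun a => hf _).trans le_self_add) (h₁.expect_le fun a => hf _)
  have step₂ : expect (indep fun j : {j // j ≠ i₀} => p j) h
      ≤ E₂ * expect (indep fun j : {j // j ≠ i₀} => p' j) h + ENNReal.ofReal δ₂ := by
    have := h₂.expect_le (f := fun o => h fun j => o j) fun o => min_le_left _ _
    rw [expect_indep_split _ i₀, expect_indep_split p' i₀] at this
    have hup : (fun j : {j // j ≠ i₀} => Function.update p i₀ (p' i₀) j)
        = fun j : {j // j ≠ i₀} => p j := by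
      funext j
      exact Function.update_of_ne j.2 _ _
    have hj : ∀ (a : α i₀) (r : ∀ j : {j // j ≠ i₀}, α j),
        (fun j : {j // j ≠ i₀} => (Equiv.piSplitAt i₀ α).symm (a, r) j) = r := by
      intro a r
      funext j
      simp [j.2]
    simpa only [hup, hj, expect_const] using this
  have step₃ : expect (indep fun j : {j // j ≠ i₀} => p' j) h ≤ E₁ * expect (indep p') f := by
    rw [expect_indep_split p' i₀, ← expect_const_mul]
    exact expect_mono _ fun r => min_le_right _ _
  calc expect (indep p) f
      ≤ E₂ * (E₁ * expect (indep p') f) + ENNReal.ofReal δ₂ + ENNReal.ofReal δ₁ := by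
        refine step₁.trans ?_
        gcongr
        refine step₂.trans ?_
        gcongr
    _ = _ := by
        rw [Real.exp_add, ENNReal.ofReal_mul (Real.exp_pos _).le, ENNReal.ofReal_add hδ₁ hδ₂]
        ring

/-- Basic composition for independent mechanisms. -/
theorem DPLe.indep {p p' : ∀ i, PMF (α i)} (ε δ : ι → ℝ) (hδ : ∀ i, 0 ≤ δ i)
    (h : ∀ i, DPLe (ε i) (δ i) (p i) (p' i)) :
    DPLe (∑ i, ε i) (∑ i, δ i) (indep p) (indep p') := by
  suffices H : ∀ (s : Finset ι) (p : ∀ i, PMF (α i)), (∀ i ∉ s, p i = p' i) →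
      (∀ i ∈ s, DPLe (ε i) (δ i) (p i) (p' i)) →
      DPLe (∑ i ∈ s, ε i) (∑ i ∈ s, δ i) (WedgeShuffle.indep p) (WedgeShuffle.indep p') from
    H Finset.univ p (by simp) fun i _ => h i
  intro s
  induction s using Finset.induction_on with
  | empty =>
    intro p hp _
    have : p = p' := funext fun i => hp i (Finset.notMem_empty i)
    subst this
    simpa using DPLe.refl _
  | insert i₀ s hi ih =>
    intro p hp hs
    rw [Finset.sum_insert hi, Finset.sum_insert hi]
    refine DPLe.indep_update i₀ (hδ i₀) (Finset.sum_nonneg fun i _ => hδ i)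
      (hs i₀ (Finset.mem_insert_self _ _)) (ih _ (fun i his => ?_) fun i his => ?_)
    · by_cases hii : i = i₀
      · subst hii
        simp
      · rw [Function.update_of_ne hii]
        exact hp i (by simp [hii, his])
    · have hii : i ≠ i₀ := fun hii => hi (hii ▸ his)
      rw [Function.update_of_ne hii]
      exact hs i (Finset.mem_insert_of_mem his)

end Composition

/-! ### The clone reduction for shuffled randomized response -/

/-- The number of `true` bits. -/
def count {ι : Type*} [Fintype ι] (y : ι → Bool) : ℕ :=
  (Finset.univ.filter fun i => y i = true).card

theorem count_le {ι : Type*} [Fintype ι] (y : ι → Bool) : count y ≤ Fintype.card ι :=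
  Finset.card_filter_le _ _

section Count

variable {ι : Type*} [Fintype ι]

/-- Bit vectors with equally many `true` bits are permutations of each other. -/
theorem exists_perm_of_count_eq {y y' : ι → Bool} (h : count y = count y') :
    ∃ π : Equiv.Perm ι, ∀ k, y' (π k) = y k := by
  classical
  have e : {i // y i = true} ≃ {i // y' i = true} :=
    Fintype.equivOfCardEq (by simpa [Fintype.card_subtype, count] using h)
  refine ⟨e.extendSubtype, fun k => ?_⟩
  by_cases hk : y k = true
  · rw [hk]
    exact e.extendSubtype_mem k hk
  · rw [Bool.eq_false_iff.2 hk, ← Bool.not_eq_true]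
    exact e.extendSubtype_not_mem k hk

/-- A permutation-invariant function of a bit vector is a function of the number of `true` bits. -/
theorem exists_eq_comp_count {F : (ι → Bool) → ℝ≥0∞} (hF : ∀ y, F y ≤ 1)
    (hsymm : ∀ (π : Equiv.Perm ι) y, F (fun k => y (π k)) = F y) :
    ∃ G : ℕ → ℝ≥0∞, (∀ c, G c ≤ 1) ∧ ∀ y, F y = G (count y) := by
  refine ⟨fun c => ⨆ (y : ι → Bool) (_ : count y = c), F y,
    fun c => iSup₂_le fun y _ => hF y, fun y => le_antisymm ?_ ?_⟩
  · exact le_iSup₂ (f := fun (z : ι → Bool) (_ : count z = count y) => F z) y rfl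
  · refine iSup₂_le fun z hz => ?_
    obtain ⟨π, hπ⟩ := exists_perm_of_count_eq hz
    have : (fun k => y (π k)) = z := funext hπ
    rw [← this, hsymm]

/-- Among independent coins, those in a fixed subset (the support of `B`) have a binomial number of
successes. -/
theorem expect_count_and [DecidableEq ι] (p : ℝ) (hp : p ∈ Set.Icc (0 : ℝ) 1) (B : ι → Bool)
    (F : ℕ → ℝ≥0∞) :
    (expect (indep fun _ : ι => bern p hp) fun u => F (count fun i => B i && u i))
      = expect (binomial (count B) p hp) F := by
  let e : Fin (count B) → ι := fun k =>
    ((Finset.univ.filter fun i => B i = true).equivFin.symm k : ι)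
  have he : Function.Injective e := Subtype.val_injective.comp (Equiv.injective _)
  have hB : ∀ i, B i = true ↔ ∃ k, e k = i := by
    intro i
    constructor
    · intro hi
      exact ⟨(Finset.univ.filter fun i => B i = true).equivFin ⟨i, by simpa using hi⟩,
        by simp [e]⟩
    · rintro ⟨k, rfl⟩
      exact (Finset.mem_filter.1
        ((Finset.univ.filter fun i => B i = true).equivFin.symm k).2).2
  have hcount : ∀ u : ι → Bool, (count fun i => B i && u i) = count fun k => u (e k) := by
    intro u
    rw [count, count, ← Finset.card_map ⟨e, he⟩]
    congr 1
    ext i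
    simp only [Bool.and_eq_true, Finset.mem_filter, Finset.mem_univ, true_and, Finset.mem_map,
      Function.Embedding.coeFn_mk, hB]
    constructor
    · rintro ⟨⟨k, rfl⟩, hu⟩
      exact ⟨k, hu, rfl⟩
    · rintro ⟨k, hu, rfl⟩
      exact ⟨⟨k, rfl⟩, hu⟩
  simp only [hcount]
  rw [expect_indep_comp (fun _ => bern p hp) he fun u => F (count u), binomial, expect_map]
  rfl

theorem expect_count [DecidableEq ι] (p : ℝ) (hp : p ∈ Set.Icc (0 : ℝ) 1) (F : ℕ → ℝ≥0∞) :
    (expect (indep fun _ : ι => bern p hp) fun u => F (count u))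
      = expect (binomial (Fintype.card ι) p hp) F := by
  have := expect_count_and p hp (fun _ : ι => true) F
  simpa [count] using this

end Count

/-- The law of the output of randomized response when it is not replaced by a fair coin, in the
decomposition `rr_eq_bind`: the input is flipped with probability `1 / (2 (e^ε + 1))`. -/
noncomputable def leftover (ε : ℝ) (x : Bool) : PMF Bool :=
  bern (if x then 1 - 1 / (2 * (Real.exp ε + 1)) else 1 / (2 * (Real.exp ε + 1))) (by
    have h := Real.exp_pos ε
    have h0 : 0 ≤ 1 / (2 * (Real.exp ε + 1)) := by positivity
    have h1 : 1 / (2 * (Real.exp ε + 1)) ≤ 1 := by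
      rw [div_le_one (by positivity)]
      linarith
    cases x
    · exact ⟨h0, h1⟩
    · exact ⟨by simpa using h1, by simpa using h0⟩)

theorem exp_neg_mem_Icc {ε : ℝ} (hε : 0 ≤ ε) : Real.exp (-ε) ∈ Set.Icc (0 : ℝ) 1 :=
  ⟨(Real.exp_pos _).le, Real.exp_le_one_iff.2 (neg_nonpos.2 hε)⟩

theorem half_mem_Icc : (1 / 2 : ℝ) ∈ Set.Icc (0 : ℝ) 1 := ⟨by norm_num, by norm_num⟩

theorem bern_apply (p : ℝ) (hp : p ∈ Set.Icc (0 : ℝ) 1) (b : Bool) :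
    bern p hp b = ENNReal.ofReal (if b then p else 1 - p) := rfl

theorem rr_apply (ε : ℝ) (x y : Bool) : rr ε x y = ENNReal.ofReal
    (if x = y then Real.exp ε / (Real.exp ε + 1) else 1 / (Real.exp ε + 1)) := rfl

/-- Randomized response ignores its input, and returns a fair coin, with probability `e^{-ε}`. -/
theorem rr_eq_bind {ε : ℝ} (hε : 0 ≤ ε) (x : Bool) :
    rr ε x = (bern (Real.exp (-ε)) (exp_neg_mem_Icc hε)).bind fun c =>
      (bern (1 / 2) half_mem_Icc).bind fun u =>
        (leftover ε x).map fun l => if c then u else l := by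
  have h1 : ((bern (1 / 2) half_mem_Icc).bind fun u =>
      (leftover ε x).map fun _ => u) = bern (1 / 2) half_mem_Icc := by
    have : ∀ u : Bool, ((leftover ε x).map fun _ => u) = PMF.pure u := fun u => PMF.map_const _ u
    simp only [this, PMF.bind_pure]
  have h2 : ((bern (1 / 2) half_mem_Icc).bind fun _ =>
      (leftover ε x).map fun l => l) = leftover ε x := by
    rw [PMF.bind_const]
    exact PMF.map_id _
  ext y
  have he := Real.exp_pos ε
  have hq : 0 ≤ 1 - Real.exp (-ε) := sub_nonneg.2 (exp_neg_mem_Icc hε).2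
  have hl : 0 ≤ 1 - 1 / (2 * (Real.exp ε + 1)) := by
    rw [sub_nonneg, div_le_one (by positivity)]
    linarith
  have hl' : 0 ≤ 1 / (2 * (Real.exp ε + 1)) := by positivity
  rw [PMF.bind_apply, tsum_bool]
  simp only [if_true, Bool.false_eq_true, if_false, h1, h2]
  simp only [leftover, bern_apply, rr_apply, if_true, Bool.false_eq_true, if_false]
  have hif : (0 : ℝ) ≤ if y = true then (if x = true then 1 - 1 / (2 * (Real.exp ε + 1))
      else 1 / (2 * (Real.exp ε + 1))) else 1 - if x = true then 1 - 1 / (2 * (Real.exp ε + 1))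
      else 1 / (2 * (Real.exp ε + 1)) := by
    split_ifs <;> linarith
  have hif' : (0 : ℝ) ≤ if y = true then 1 / 2 else 1 - 1 / 2 := by
    split_ifs <;> norm_num
  rw [← ENNReal.ofReal_mul hq, ← ENNReal.ofReal_mul (Real.exp_pos _).le,
    ← ENNReal.ofReal_add (mul_nonneg hq hif) (mul_nonneg (Real.exp_pos _).le hif')]
  congr 1
  rw [Real.exp_neg]
  cases x <;> cases y <;> simp <;> field_simp <;> ring

section Reduction

variable {ι : Type*} [Fintype ι] [DecidableEq ι]

/-- The reports of users with fixed inputs, together with one more bit `d`, are a post-processing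
of clones: the number of `true` reports is obtained from `(A + d, C - A + 1 - d)` by a kernel that
does not depend on `d`. Here `C` is the number of users that return a fair coin, and `A` the number
of these coins that show `true`. The kernel recovers `C` as the sum of the two numbers minus `1`,
resamples from the conditional law given `C` the set of users that return a fair coin, and adds the
reports of the remaining users. -/
theorem exists_clone_kernel {ε : ℝ} (hε : 0 ≤ ε) (x : ι → Bool) {G : ℕ → ℝ≥0∞}
    (hG : ∀ c, G c ≤ 1) :
    ∃ g : ℕ × ℕ → ℝ≥0∞, (∀ o, g o ≤ 1) ∧ ∀ d : Bool,
      (expect (indep fun i => rr ε (x i)) fun y => G (count y + d.toNat))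
        = expect (binomial (Fintype.card ι) (Real.exp (-ε)) (exp_neg_mem_Icc hε)) fun C =>
            expect (binomial C (1 / 2) half_mem_Icc) fun A =>
              g (if d then (A + 1, C - A) else (A, C - A + 1)) := by
  set P := indep fun _ : ι => bern (Real.exp (-ε)) (exp_neg_mem_Icc hε)
  set T : ℕ → (ι → Bool) → ℝ≥0∞ := fun a B =>
    expect (indep fun i => leftover ε (x i)) fun l => G (a + count fun i => !B i && l i) with hT
  have hT1 : ∀ a B, T a B ≤ 1 := fun a B => expect_le_one _ fun l => hG _
  refine ⟨fun o => condExpect P count (T o.1) (o.1 + o.2 - 1),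
    fun o => condExpect_le_one _ _ (hT1 _) _, fun d => ?_⟩
  have hsplit : ∀ B u l : ι → Bool, (count fun i => if B i = true then u i else l i)
      = (count fun i => B i && u i) + count fun i => !B i && l i := by
    intro B u l
    simp only [count, Finset.card_filter, ← Finset.sum_add_distrib]
    refine Finset.sum_congr rfl fun i _ => ?_
    cases B i <;> simp
  calc (expect (indep fun i => rr ε (x i)) fun y => G (count y + d.toNat))
      = expect P fun B => expect (indep fun _ : ι => bern (1 / 2) half_mem_Icc) fun u =>
          T ((count fun i => B i && u i) + d.toNat) B := by
        simp only [rr_eq_bind hε, expect_indep_bind, expect_indep_map, hsplit, hT]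
        simp only [add_right_comm]
        rfl
    _ = expect P fun B => expect (binomial (count B) (1 / 2) half_mem_Icc) fun A =>
          T (A + d.toNat) B := by
        congr 1
        funext B
        exact expect_count_and _ _ B fun A => T (A + d.toNat) B
    _ = expect (P.map count) fun C => expect (binomial C (1 / 2) half_mem_Icc) fun A =>
          condExpect P count (T (A + d.toNat)) C :=
        expect_expect_condExpect P count (fun C => binomial C (1 / 2) half_mem_Icc)
          fun a B => hT1 _ B
    _ = _ := by
        rw [expect_map, ← expect_count]
        congr 1
        funext B
        rw [binomial, expect_map, expect_map]
        congr 1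
        funext u
        -- the number `C` is recovered because at most `C` of the `C` coins show `true`
        have hu : count u ≤ count B := (count_le u).trans_eq (Fintype.card_fin _)
        change condExpect P count (T (count u + d.toNat)) (count B)
          = condExpect P count (T (if d = true then (count u + 1, count B - count u)
              else (count u, count B - count u + 1)).1) _
        cases d
        · have : count u + (count B - count u + 1) - 1 = count B := by omega
          simp [count] at this ⊢
          rw [this]
        · have : count u + 1 + (count B - count u) - 1 = count B := by omega
          simp [count] at this ⊢
          rw [this]

/-- The number of `true` reports is a post-processing of the clone law. -/
theorem exists_expect_cloneLaw {ε : ℝ} (hε : 0 ≤ ε) (i₀ : ι) (x : ι → Bool) {G : ℕ → ℝ≥0∞}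
    (hG : ∀ c, G c ≤ 1) :
    ∃ g : ℕ × ℕ → ℝ≥0∞, (∀ o, g o ≤ 1) ∧ ∀ x' : ι → Bool, (∀ i ≠ i₀, x' i = x i) →
      (expect (indep fun i => rr ε (x' i)) fun y => G (count y))
        = expect (cloneLaw (Fintype.card ι) ε hε (x' i₀)) g := by
  obtain ⟨g, hg, h⟩ := exists_clone_kernel hε (fun j : {j // j ≠ i₀} => x j) hG
  refine ⟨g, hg, fun x' hx => ?_⟩
  have hcount : ∀ (a : Bool) (r : ∀ _ : {j // j ≠ i₀}, Bool),
      count ((Equiv.piSplitAt i₀ fun _ => Bool).symm (a, r)) = count r + a.toNat := by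
    intro a r
    simp only [count, Finset.card_filter]
    rw [Fintype.sum_eq_add_sum_subtype_ne _ i₀, add_comm]
    congr 1
    · refine Finset.sum_congr rfl fun j _ => ?_
      simp [j.2]
    · cases a <;> simp
  have hx' : (fun j : {j // j ≠ i₀} => rr ε (x' j)) = fun j : {j // j ≠ i₀} => rr ε (x j) :=
    funext fun j => by rw [hx j j.2]
  have hcard : Fintype.card {j // j ≠ i₀} = Fintype.card ι - 1 := by
    simp [Fintype.card_subtype_compl]
  rw [expect_indep_split _ i₀, hx']
  simp only [hcount]
  rw [expect_comm]
  simp only [h]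
  rw [cloneLaw, expect_bind, expect_comm, hcard]
  congr 1
  funext C
  rw [expect_bind, expect_comm]
  congr 1
  funext A
  rw [expect_map]

/-- Privacy of shuffled randomized response: a permutation-invariant test cannot distinguish inputs
that differ for one user better than the clone laws can be distinguished. -/
theorem expect_rr_le_of_numericalBound {ε δ εL : ℝ} (hε : 0 ≤ ε) (hεL : 0 ≤ εL)
    (hN : NumericalBound (Fintype.card ι) εL hεL ε δ) (i₀ : ι) {x x' : ι → Bool}
    (hx : ∀ i ≠ i₀, x' i = x i) {F : (ι → Bool) → ℝ≥0∞} (hF : ∀ y, F y ≤ 1)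
    (hsymm : ∀ (π : Equiv.Perm ι) y, F (fun k => y (π k)) = F y) :
    expect (indep fun i => rr εL (x i)) F ≤ ENNReal.ofReal (Real.exp ε) *
      expect (indep fun i => rr εL (x' i)) F + ENNReal.ofReal δ := by
  obtain ⟨G, hG, hFG⟩ := exists_eq_comp_count hF hsymm
  obtain ⟨g, hg, h⟩ := exists_expect_cloneLaw hεL i₀ x hG
  obtain rfl : F = fun y => G (count y) := funext hFG
  rw [h x fun _ _ => rfl, h x' hx]
  cases h1 : x i₀ <;> cases h2 : x' i₀
  · refine le_add_right (le_mul_of_one_le_left zero_le ?_)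
    simpa using hε
  · exact hN.2.expect_le hg
  · exact hN.1.expect_le hg
  · refine le_add_right (le_mul_of_one_le_left zero_le ?_)
    simpa using hε

end Reduction

/-! ### Binomial expectations -/

theorem expect_binomial_half (c : ℕ) (F : ℕ → ℝ≥0∞) :
    expect (binomial c (1 / 2) half_mem_Icc) F
      = ENNReal.ofReal (1 / 2) ^ c * ∑ A ∈ Finset.range (c + 1), (c.choose A : ℝ≥0∞) * F A := by
  have h1 : ∀ u : Fin c → Bool, indep (fun _ : Fin c => bern (1 / 2) half_mem_Icc) u
      = ENNReal.ofReal (1 / 2) ^ c := by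
    intro u
    have h2 : ∀ b : Bool, bern (1 / 2) half_mem_Icc b = ENNReal.ofReal (1 / 2) := by
      intro b
      rw [bern_apply]
      cases b <;> norm_num
    simp only [indep_apply, h2, Finset.prod_const, Finset.card_univ, Fintype.card_fin]
  have h3 : Function.Bijective fun (u : Fin c → Bool) =>
      Finset.univ.filter fun i => u i = true := by
    refine ⟨fun u u' h => funext fun i => ?_, fun s => ⟨fun i => decide (i ∈ s), by ext i; simp⟩⟩
    have := Finset.ext_iff.1 h i
    exact Bool.eq_iff_iff.2 (by simpa using this)
  rw [binomial, expect_map, expect_fintype]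
  simp only [h1, ← Finset.mul_sum]
  congr 1
  rw [h3.sum_comp fun s : Finset (Fin c) => F s.card]
  have := Finset.sum_powerset_apply_card F (x := (Finset.univ : Finset (Fin c)))
  simpa [Finset.powerset_univ] using this

theorem expect_binomial_half_reflect (c : ℕ) (F : ℕ → ℝ≥0∞) :
    (expect (binomial c (1 / 2) half_mem_Icc) fun A => F (c - A))
      = expect (binomial c (1 / 2) half_mem_Icc) F := by
  rw [expect_binomial_half, expect_binomial_half, ← Finset.sum_range_reflect]
  congr 1
  refine Finset.sum_congr rfl fun A hA => ?_
  have hA' : A ≤ c := Nat.lt_succ_iff.1 (Finset.mem_range.1 hA)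
  have h1 : c + 1 - 1 - A = c - A := by omega
  rw [h1, Nat.choose_symm hA', Nat.sub_sub_self hA']

theorem expect_binomial_half_congr (c : ℕ) {F G : ℕ → ℝ≥0∞} (h : ∀ A ≤ c, F A = G A) :
    expect (binomial c (1 / 2) half_mem_Icc) F = expect (binomial c (1 / 2) half_mem_Icc) G := by
  rw [expect_binomial_half, expect_binomial_half]
  congr 1
  refine Finset.sum_congr rfl fun A hA => ?_
  rw [h A (Nat.lt_succ_iff.1 (Finset.mem_range.1 hA))]

theorem expect_binomial_half_pow (c : ℕ) (α β : ℝ≥0∞) :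
    (expect (binomial c (1 / 2) half_mem_Icc) fun A => α ^ A * β ^ (c - A))
      = (ENNReal.ofReal (1 / 2) * (α + β)) ^ c := by
  rw [expect_binomial_half, mul_pow, add_pow]
  congr 1
  exact Finset.sum_congr rfl fun A _ => mul_comm _ _

theorem expect_binomial_pow (N : ℕ) (p : ℝ) (hp : p ∈ Set.Icc (0 : ℝ) 1) (r : ℝ≥0∞) :
    (expect (binomial N p hp) fun k => r ^ k)
      = (ENNReal.ofReal p * r + ENNReal.ofReal (1 - p)) ^ N := by
  have h : ∀ u : Fin N → Bool, r ^ (Finset.univ.filter fun i => u i = true).card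
      = ∏ i, if u i = true then r else 1 := by
    intro u
    rw [Finset.prod_ite]
    simp
  rw [binomial, expect_map]
  simp only [h]
  rw [expect_indep_prod (fun _ : Fin N => bern p hp) fun _ b => if b = true then r else 1]
  simp [expect_fintype, bern_apply]

/-! ### Symmetry of the clone laws -/

theorem rr_not_not (ε : ℝ) (x b : Bool) : rr ε (!x) (!b) = rr ε x b := by
  cases x <;> cases b <;> rfl

theorem expect_rr_not (ε : ℝ) (x : Bool) (f : Bool → ℝ≥0∞) :
    expect (rr ε (!x)) f = expect (rr ε x) fun b => f (!b) := by
  simp only [expect_fintype, Fintype.sum_bool, ← rr_not_not ε x, Bool.not_true, Bool.not_false]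
  exact add_comm _ _

theorem expect_cloneLaw (m : ℕ) {εL : ℝ} (hεL : 0 ≤ εL) (x : Bool) (g : ℕ × ℕ → ℝ≥0∞) :
    expect (cloneLaw m εL hεL x) g
      = expect (binomial (m - 1) (Real.exp (-εL)) (exp_neg_mem_Icc hεL)) fun C =>
          expect (binomial C (1 / 2) half_mem_Icc) fun A =>
            expect (rr εL x) fun b => g (if b then (A + 1, C - A) else (A, C - A + 1)) := by
  simp only [cloneLaw, expect_bind, expect_map]

theorem map_swap_cloneLaw (m : ℕ) {εL : ℝ} (hεL : 0 ≤ εL) (x : Bool) :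
    (cloneLaw m εL hεL x).map Prod.swap = cloneLaw m εL hεL (!x) := by
  classical
  have key : ∀ g, expect (cloneLaw m εL hεL x) (fun o => g o.swap)
      = expect (cloneLaw m εL hεL (!x)) g := by
    intro g
    rw [expect_cloneLaw, expect_cloneLaw]
    congr 1
    funext C
    rw [← expect_binomial_half_reflect]
    refine expect_binomial_half_congr C fun A hA => ?_
    rw [expect_rr_not]
    congr 1
    funext b
    cases b <;> simp [Nat.sub_sub_self hA]
  ext o
  have h1 : ∀ P : PMF (ℕ × ℕ), P o = expect P fun o' => if o' = o then 1 else 0 := by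
    intro P
    rw [expect, tsum_eq_single o]
    · simp
    · intro b hb
      simp [hb]
  rw [h1, h1 (cloneLaw m εL hεL (!x)), expect_map, ← key]

theorem numericalBound_of_dpLe {m : ℕ} {εL ε δ : ℝ} {hεL : 0 ≤ εL}
    (h : DPLe ε δ (cloneLaw m εL hεL true) (cloneLaw m εL hεL false)) :
    NumericalBound m εL hεL ε δ := by
  refine ⟨h, ?_⟩
  have := h.map Prod.swap
  rwa [map_swap_cloneLaw, map_swap_cloneLaw] at this

/-! ### The likelihood ratio of the clone laws -/

/-- Given `C = c`, the clone law is supported on the pairs `(k, c + 1 - k)`. -/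
theorem expect_clone_eq_sum (c : ℕ) (ε : ℝ) (x : Bool) (g : ℕ × ℕ → ℝ≥0∞) :
    (expect (binomial c (1 / 2) half_mem_Icc) fun A =>
        expect (rr ε x) fun b => g (if b then (A + 1, c - A) else (A, c - A + 1)))
      = ENNReal.ofReal (1 / 2) ^ c * ∑ k ∈ Finset.range (c + 2),
          (rr ε x true * (if k = 0 then 0 else c.choose (k - 1) : ℕ)
            + rr ε x false * (c.choose k : ℕ)) * g (k, c + 1 - k) := by
  rw [expect_binomial_half]
  congr 1
  simp only [expect_fintype, Fintype.sum_bool, if_true, Bool.false_eq_true, if_false, add_mul,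
    mul_add, Finset.sum_add_distrib]
  congr 1
  · rw [Finset.sum_range_succ' _ (c + 1)]
    simp only [if_true, Nat.cast_zero, mul_zero, zero_mul, add_zero]
    refine Finset.sum_congr rfl fun A _ => ?_
    simp only [Nat.add_eq_zero_iff, one_ne_zero, and_false, if_false, Nat.add_sub_cancel,
      Nat.add_sub_add_right]
    ring
  · rw [Finset.sum_range_succ _ (c + 1)]
    simp only [Nat.choose_succ_self, Nat.cast_zero, mul_zero, zero_mul, add_zero]
    refine Finset.sum_congr rfl fun A hA => ?_
    have hA' : A ≤ c := Nat.lt_succ_iff.1 (Finset.mem_range.1 hA)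
    rw [Nat.sub_add_comm hA']
    ring

/-- With `e = e^{ε_L}`, the likelihood ratio `(e a + b) / (a + e b)` of the clone laws at `(a, b)`
is at most `1 + (e - 1) / (e + 1) * X` unless `a - b` is large. -/
theorem likelihood_ratio_le {e X a b : ℝ} (he : 1 ≤ e) (hX : 0 ≤ X) (ha : 0 ≤ a) (hb : 0 ≤ b)
    (h : (a - b) * (2 + X) ≤ X * (a + b)) :
    e * a + b ≤ (1 + (e - 1) / (e + 1) * X) * (a + e * b) := by
  have key : (a - b) * (e + 1) ≤ X * (a + e * b) := by
    rcases le_total a b with hab | hab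
    · have h1 : (a - b) * (e + 1) ≤ 0 :=
        mul_nonpos_of_nonpos_of_nonneg (by linarith) (by linarith)
      have h2 : 0 ≤ X * (a + e * b) := by positivity
      linarith
    · have h1 : a - b ≤ X * b := by linarith
      have h2 : 0 ≤ X * (a - b) := mul_nonneg hX (by linarith)
      nlinarith [mul_le_mul_of_nonneg_right h1 (by linarith : 0 ≤ e + 1)]
  have h1 : (1 + (e - 1) / (e + 1) * X) * (a + e * b) - (e * a + b)
      = (e - 1) / (e + 1) * (X * (a + e * b) - (a - b) * (e + 1)) := by
    field_simp
    ring
  have h2 : 0 ≤ (e - 1) / (e + 1) * (X * (a + e * b) - (a - b) * (e + 1)) :=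
    mul_nonneg (div_nonneg (by linarith) (by linarith)) (by linarith)
  linarith

/-- Weights proportional to `a` and `b`, as are two adjacent binomial coefficients, inherit the
likelihood ratio bound at `(a, b)`. -/
theorem mixture_le_of_proportional {e X a b u v : ℝ} (he : 1 ≤ e) (hX : 0 ≤ X) (ha : 0 ≤ a)
    (hb : 0 ≤ b) (hab : 0 < a + b) (hu : 0 ≤ u) (hv : 0 ≤ v) (huv : u * b = v * a)
    (h : (a - b) * (2 + X) ≤ X * (a + b)) :
    e / (e + 1) * u + 1 / (e + 1) * v
      ≤ (1 + (e - 1) / (e + 1) * X) * (1 / (e + 1) * u + e / (e + 1) * v) := by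
  obtain ⟨w, hw, rfl, rfl⟩ : ∃ w, 0 ≤ w ∧ u = w * a ∧ v = w * b := by
    refine ⟨(u + v) / (a + b), by positivity, ?_, ?_⟩ <;> field_simp <;> linarith
  have hw' : 0 ≤ w / (e + 1) := by positivity
  have := mul_le_mul_of_nonneg_left (likelihood_ratio_le he hX ha hb h) hw'
  calc e / (e + 1) * (w * a) + 1 / (e + 1) * (w * b)
      = w / (e + 1) * (e * a + b) := by ring
    _ ≤ _ := this
    _ = _ := by ring

/-- Off the event `(a - b) (2 + X) > X (a + b)` the two clone laws are within the factor
`1 + (e^{ε_L} - 1) / (e^{ε_L} + 1) * X`. -/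
theorem expect_cloneLaw_le_mul (m : ℕ) {εL X : ℝ} (hεL : 0 ≤ εL) (hX : 0 ≤ X)
    {g : ℕ × ℕ → ℝ≥0∞}
    (hg : ∀ o : ℕ × ℕ, X * (o.1 + o.2) < ((o.1 : ℝ) - o.2) * (2 + X) → g o = 0) :
    expect (cloneLaw m εL hεL true) g
      ≤ ENNReal.ofReal (1 + (Real.exp εL - 1) / (Real.exp εL + 1) * X) *
        expect (cloneLaw m εL hεL false) g := by
  set E := 1 + (Real.exp εL - 1) / (Real.exp εL + 1) * X with hE
  have he : 1 ≤ Real.exp εL := Real.one_le_exp hεL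
  have hE0 : 0 ≤ E := by
    have : 0 ≤ (Real.exp εL - 1) / (Real.exp εL + 1) * X :=
      mul_nonneg (div_nonneg (by linarith) (by linarith)) hX
    linarith
  rw [expect_cloneLaw, expect_cloneLaw, ← expect_const_mul]
  refine expect_mono _ fun c => ?_
  rw [expect_clone_eq_sum, expect_clone_eq_sum, mul_left_comm (ENNReal.ofReal E)]
  refine mul_le_mul_right ?_ _
  rw [Finset.mul_sum]
  refine Finset.sum_le_sum fun k hk => ?_
  by_cases hbad : X * (((k : ℕ) : ℝ) + ((c + 1 - k : ℕ) : ℝ))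
      < ((k : ℝ) - ((c + 1 - k : ℕ) : ℝ)) * (2 + X)
  · rw [hg (k, c + 1 - k) hbad]
    simp
  rw [← mul_assoc]
  gcongr
  have hk' : k ≤ c + 1 := Nat.lt_succ_iff.1 (Finset.mem_range.1 hk)
  set u : ℕ := if k = 0 then 0 else c.choose (k - 1) with hu
  have huv : u * (c + 1 - k) = c.choose k * k := by
    rw [hu]
    rcases k with _ | k
    · simp
    · simp only [Nat.add_eq_zero_iff, one_ne_zero, and_false, if_false, Nat.add_sub_cancel,
        Nat.add_sub_add_right]
      exact (Nat.choose_succ_right_eq c k).symm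
  have hsum : (k : ℝ) + ((c + 1 - k : ℕ) : ℝ) = c + 1 := by
    rw [← Nat.cast_add, Nat.add_sub_cancel' hk']
    push_cast
    ring
  have key := mixture_le_of_proportional (u := (u : ℝ)) (v := (c.choose k : ℝ)) he hX
    (Nat.cast_nonneg k) (Nat.cast_nonneg (c + 1 - k)) (by rw [hsum]; positivity)
    (Nat.cast_nonneg _) (Nat.cast_nonneg _) (by exact_mod_cast huv) (not_lt.1 hbad)
  have hp : 0 ≤ Real.exp εL / (Real.exp εL + 1) := by positivity
  have hp' : 0 ≤ 1 / (Real.exp εL + 1) := by positivity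
  simp only [rr_apply, if_true, Bool.false_eq_true, Bool.true_eq_false, if_false]
  rw [← ENNReal.ofReal_natCast u, ← ENNReal.ofReal_natCast (c.choose k), ← ENNReal.ofReal_mul hp,
    ← ENNReal.ofReal_mul hp', ← ENNReal.ofReal_mul hp', ← ENNReal.ofReal_mul hp,
    ← ENNReal.ofReal_add (by positivity) (by positivity),
    ← ENNReal.ofReal_add (by positivity) (by positivity), ← ENNReal.ofReal_mul hE0]
  exact ENNReal.ofReal_le_ofReal key

/-! ### The tail of the clone law -/

/-- Chernoff bound for the event that the two numbers of clones differ by a fraction `τ` of their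
sum. The moment generating function of the number `C` of clones is used directly, so that `C` need
not be bounded below. -/
theorem expect_cloneLaw_tail_le {m : ℕ} (hm : 1 ≤ m) {εL τ : ℝ} (hεL : 0 ≤ εL) (hτ : 0 ≤ τ)
    {g : ℕ × ℕ → ℝ≥0∞} (hg1 : ∀ o, g o ≤ 1)
    (hg : ∀ o : ℕ × ℕ, (o.1 : ℝ) - o.2 < τ * (o.1 + o.2) → g o = 0) :
    expect (cloneLaw m εL hεL true) g
      ≤ ENNReal.ofReal (2 * Real.exp (-(m * Real.exp (-εL) * (1 - Real.exp (-(τ ^ 2 / 2)))))) := by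
  set α := ENNReal.ofReal (Real.exp (τ - τ ^ 2)) with hα
  set β := ENNReal.ofReal (Real.exp (-τ - τ ^ 2)) with hβ
  set r := Real.exp (-(τ ^ 2 / 2)) with hr
  set q := Real.exp (-εL) with hq
  have hq1 : q ≤ 1 := (exp_neg_mem_Icc hεL).2
  have hr1 : r ≤ 1 := Real.exp_le_one_iff.2 (by have := sq_nonneg τ; linarith)
  have hexp : ∀ o : ℕ × ℕ, g o ≤ α ^ o.1 * β ^ o.2 := by
    intro o
    by_cases ho : (o.1 : ℝ) - o.2 < τ * (o.1 + o.2)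
    · rw [hg o ho]
      exact zero_le
    · refine (hg1 o).trans ?_
      rw [hα, hβ, ← ENNReal.ofReal_pow (Real.exp_pos _).le,
        ← ENNReal.ofReal_pow (Real.exp_pos _).le, ← ENNReal.ofReal_mul (by positivity),
        ← Real.exp_nat_mul, ← Real.exp_nat_mul, ← Real.exp_add, ENNReal.one_le_ofReal]
      refine Real.one_le_exp ?_
      have := mul_nonneg hτ (sub_nonneg.2 (not_lt.1 ho))
      nlinarith
  have hs : ENNReal.ofReal (1 / 2) * (α + β) ≤ ENNReal.ofReal r := by
    rw [hα, hβ, ← ENNReal.ofReal_add (by positivity) (by positivity),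
      ← ENNReal.ofReal_mul (by norm_num)]
    refine ENNReal.ofReal_le_ofReal ?_
    calc 1 / 2 * (Real.exp (τ - τ ^ 2) + Real.exp (-τ - τ ^ 2))
        = Real.cosh τ * Real.exp (-τ ^ 2) := by
          rw [Real.cosh_eq, sub_eq_add_neg τ, sub_eq_add_neg (-τ), Real.exp_add, Real.exp_add]
          ring
      _ ≤ Real.exp (τ ^ 2 / 2) * Real.exp (-τ ^ 2) := by
          gcongr
          exact Real.cosh_le_exp_half_sq τ
      _ = r := by
          rw [← Real.exp_add, hr]
          congr 1
          ring
  have hαβ : α + β ≤ 2 * ENNReal.ofReal r := by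
    have h2 : (2 : ℝ≥0∞) * ENNReal.ofReal (1 / 2) = 1 := by
      rw [← ENNReal.ofReal_ofNat, ← ENNReal.ofReal_mul (by norm_num)]
      norm_num
    calc α + β = 2 * (ENNReal.ofReal (1 / 2) * (α + β)) := by rw [← mul_assoc, h2, one_mul]
      _ ≤ _ := by gcongr
  have hC : ∀ C : ℕ, (expect (binomial C (1 / 2) half_mem_Icc) fun A =>
      expect (rr εL true) fun b => g (if b then (A + 1, C - A) else (A, C - A + 1)))
        ≤ (2 * ENNReal.ofReal r) * ENNReal.ofReal r ^ C := by
    intro C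
    calc _ ≤ expect (binomial C (1 / 2) half_mem_Icc) fun A =>
          (α + β) * (α ^ A * β ^ (C - A)) := by
          refine expect_mono _ fun A => ?_
          rw [expect_fintype, Fintype.sum_bool]
          calc _ ≤ g (A + 1, C - A) + g (A, C - A + 1) := by
                gcongr
                · exact mul_le_of_le_one_left' (PMF.coe_le_one _ _)
                · exact mul_le_of_le_one_left' (PMF.coe_le_one _ _)
            _ ≤ α ^ (A + 1) * β ^ (C - A) + α ^ A * β ^ (C - A + 1) :=
                add_le_add (hexp _) (hexp _)
            _ = _ := by ring
      _ = (α + β) * (ENNReal.ofReal (1 / 2) * (α + β)) ^ C := by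
          rw [expect_const_mul, expect_binomial_half_pow]
      _ ≤ _ := by gcongr
  have hmix : ENNReal.ofReal q * ENNReal.ofReal r + ENNReal.ofReal (1 - q)
      = ENNReal.ofReal (q * r + (1 - q)) := by
    rw [← ENNReal.ofReal_mul (Real.exp_pos _).le, ← ENNReal.ofReal_add (by positivity)
      (by linarith)]
  -- the surplus factor `r` takes the place of an `m`-th factor of the generating function
  have hrmix : r ≤ q * r + (1 - q) := by nlinarith
  have hmix0 : 0 ≤ q * r + (1 - q) := (Real.exp_pos _).le.trans hrmix
  calc expect (cloneLaw m εL hεL true) g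
      ≤ 2 * ENNReal.ofReal r * ENNReal.ofReal (q * r + (1 - q)) ^ (m - 1) := by
        rw [expect_cloneLaw, ← hmix, ← expect_binomial_pow, ← expect_const_mul]
        exact expect_mono _ hC
    _ ≤ 2 * ENNReal.ofReal (q * r + (1 - q)) * ENNReal.ofReal (q * r + (1 - q)) ^ (m - 1) := by
        gcongr
    _ = 2 * ENNReal.ofReal (q * r + (1 - q)) ^ m := by
        rw [mul_assoc, mul_pow_sub_one (by omega)]
    _ = ENNReal.ofReal (2 * (q * r + (1 - q)) ^ m) := by
        rw [ENNReal.ofReal_mul (by norm_num), ENNReal.ofReal_pow hmix0, ENNReal.ofReal_ofNat]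
    _ ≤ _ := by
        refine ENNReal.ofReal_le_ofReal ?_
        have h1 : q * r + (1 - q) ≤ Real.exp (-(q * (1 - r))) := by
          have := Real.add_one_le_exp (-(q * (1 - r)))
          linarith
        have h2 : Real.exp (-(m * q * (1 - r))) = Real.exp (-(q * (1 - r))) ^ m := by
          rw [← Real.exp_nat_mul]
          congr 1
          ring
        rw [h2]
        gcongr

/-! ### The closed-form bound -/

theorem sq_le_one_sub_exp {v τ : ℝ} (hv : 0 ≤ v) (hv8 : v ^ 2 ≤ 1 / 8)
    (hτ : τ = 4 * v / (1 + 4 * v)) : v ^ 2 ≤ 1 - Real.exp (-(τ ^ 2 / 2)) := by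
  have h1 : Real.exp (-(τ ^ 2 / 2)) ≤ 1 / (1 + τ ^ 2 / 2) := by
    rw [Real.exp_neg, ← one_div]
    refine one_div_le_one_div_of_le (by positivity) ?_
    have := Real.add_one_le_exp (τ ^ 2 / 2)
    linarith
  have h2 : v ^ 2 ≤ 1 - 1 / (1 + τ ^ 2 / 2) := by
    have h3 : 1 - 1 / (1 + τ ^ 2 / 2) = 16 * v ^ 2 / (2 * (1 + 4 * v) ^ 2 + 16 * v ^ 2) := by
      rw [hτ]
      have : (0 : ℝ) < 1 + 4 * v := by linarith
      field_simp
      ring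
    rw [h3, le_div_iff₀ (by positivity)]
    have h4 : v ≤ 1 / 2 := by nlinarith
    have h5 : 2 * (1 + 4 * v) ^ 2 + 16 * v ^ 2 ≤ 16 := by nlinarith
    calc v ^ 2 * (2 * (1 + 4 * v) ^ 2 + 16 * v ^ 2) ≤ v ^ 2 * 16 := by gcongr
      _ = _ := by ring
  linarith

theorem numericalBound_of_closedFormBound {m : ℕ} (hm : 1 ≤ m) {εL ε δ : ℝ} (hεL : 0 ≤ εL)
    (hδ1 : δ ≤ 1) (h : ClosedFormBound m εL ε δ) : NumericalBound m εL hεL ε δ := by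
  classical
  obtain ⟨hδ, hle, rfl⟩ := h
  refine numericalBound_of_dpLe (.of_expect fun f hf => ?_)
  have hm0 : (0 : ℝ) < m := by exact_mod_cast hm
  have he : 1 ≤ Real.exp εL := Real.one_le_exp hεL
  set e := Real.exp εL with he_def
  have he0 : 0 < e := Real.exp_pos _
  set L := Real.log (2 / δ) with hL
  set L₄ := Real.log (4 / δ) with hL₄
  have hL0 : 0 < L := Real.log_pos (by rw [lt_div_iff₀ hδ]; linarith)
  have hL₄0 : 0 < L₄ := Real.log_pos (by rw [lt_div_iff₀ hδ]; linarith)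
  have hL₄L : L₄ ≤ 2 * L := by
    have : 2 * L = Real.log ((2 / δ) ^ 2) := by
      rw [Real.log_pow, Nat.cast_ofNat]
    rw [this]
    refine Real.log_le_log (by positivity) ?_
    rw [div_pow, div_le_div_iff₀ hδ (by positivity)]
    nlinarith
  have hM : 16 * L * e ≤ m := by
    have h1 : e ≤ m / (16 * L) := (Real.le_log_iff_exp_le (by positivity)).1 hle
    rw [le_div_iff₀ (by positivity)] at h1
    linarith
  -- `v` is chosen so that `m e^{-ε_L} v² = log (4 / δ)`
  set v := √(e * L₄) / √(m : ℝ) with hv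
  have hv0 : 0 ≤ v := by positivity
  have hv2 : v ^ 2 = e * L₄ / m := by
    rw [hv, div_pow, Real.sq_sqrt (by positivity), Real.sq_sqrt hm0.le]
  have hv8 : v ^ 2 ≤ 1 / 8 := by
    rw [hv2, div_le_div_iff₀ hm0 (by norm_num)]
    nlinarith
  set τ := 4 * v / (1 + 4 * v) with hτ
  have hτ0 : 0 ≤ τ := by positivity
  set X := 8 * √(e * L₄) / √(m : ℝ) + 8 * e / (m : ℝ) with hX
  have hXv : 8 * v ≤ X := by
    have h1 : 8 * v = 8 * √(e * L₄) / √(m : ℝ) := by rw [hv]; ring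
    have h2 : 0 ≤ 8 * e / (m : ℝ) := by positivity
    rw [h1, hX]
    linarith
  have hX0 : 0 ≤ X := by linarith
  have hτX : τ * (2 + X) ≤ X := by
    rw [hτ, div_mul_eq_mul_div, div_le_iff₀ (by positivity)]
    linarith
  have hexp : Real.exp (amplification m εL δ) = 1 + (e - 1) / (e + 1) * X := by
    rw [amplification, Real.exp_log]
    have : 0 ≤ (e - 1) / (e + 1) * X :=
      mul_nonneg (div_nonneg (by linarith) (by linarith)) hX0
    linarith
  have htail : 2 * Real.exp (-(m * Real.exp (-εL) * (1 - Real.exp (-(τ ^ 2 / 2))))) ≤ δ := by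
    have h1 : L₄ ≤ m * Real.exp (-εL) * (1 - Real.exp (-(τ ^ 2 / 2))) := by
      calc L₄ = m * Real.exp (-εL) * v ^ 2 := by
            rw [hv2, Real.exp_neg, ← he_def]
            field_simp
        _ ≤ _ := by
            gcongr
            exact sq_le_one_sub_exp hv0 hv8 hτ
    have h2 : Real.exp (-L₄) = δ / 4 := by
      rw [hL₄, Real.exp_neg, Real.exp_log (by positivity), inv_div]
    have h3 : Real.exp (-(m * Real.exp (-εL) * (1 - Real.exp (-(τ ^ 2 / 2))))) ≤ δ / 4 := by
      rw [← h2]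
      exact Real.exp_le_exp.2 (neg_le_neg h1)
    linarith
  set S : Set (ℕ × ℕ) := {o | X * (o.1 + o.2) < ((o.1 : ℝ) - o.2) * (2 + X)} with hS
  have hsplit : f = fun o => Sᶜ.indicator f o + S.indicator f o := by
    funext o
    exact (Set.indicator_compl_add_self_apply S f o).symm
  calc expect (cloneLaw m εL hεL true) f
      = expect (cloneLaw m εL hεL true) (Sᶜ.indicator f)
        + expect (cloneLaw m εL hεL true) (S.indicator f) := by
        conv_lhs => rw [hsplit]
        exact expect_add _ _ _
    _ ≤ ENNReal.ofReal (1 + (e - 1) / (e + 1) * X)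
          * expect (cloneLaw m εL hεL false) (Sᶜ.indicator f) + ENNReal.ofReal δ := by
        refine add_le_add (expect_cloneLaw_le_mul m hεL hX0 fun o ho => ?_)
          ((expect_cloneLaw_tail_le hm hεL hτ0 (fun o => ?_) fun o ho => ?_).trans
            (ENNReal.ofReal_le_ofReal htail))
        · have ho' : o ∉ Sᶜ := Set.notMem_compl_iff.2 ho
          exact Set.indicator_of_notMem ho' f
        · exact (Set.indicator_le_self _ _ _).trans (hf o)
        · refine Set.indicator_of_notMem (fun hc => ?_) _
          have h1 : X * (o.1 + o.2) < ((o.1 : ℝ) - o.2) * (2 + X) := hc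
          have h2 : (0 : ℝ) ≤ (o.1 : ℝ) + o.2 := by positivity
          have h3 := mul_le_mul_of_nonneg_right hτX h2
          have h4 : ((o.1 : ℝ) - o.2) * (2 + X) ≤ τ * (o.1 + o.2) * (2 + X) := by gcongr
          linarith
    _ ≤ _ := by
        rw [hexp]
        gcongr
        exact expect_mono _ fun o => Set.indicator_le_self _ _ _

/-! ### Privacy of one run of `WSLE` -/

theorem dpLe_rr {ε : ℝ} (hε : 0 ≤ ε) (x y : Bool) : DPLe ε 0 (rr ε x) (rr ε y) := by
  have h : ∀ z, rr ε x z ≤ ENNReal.ofReal (Real.exp ε) * rr ε y z := by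
    intro z
    have he : 1 ≤ Real.exp ε := Real.one_le_exp hε
    rw [rr_apply, rr_apply, ← ENNReal.ofReal_mul (Real.exp_pos _).le]
    refine ENNReal.ofReal_le_ofReal ?_
    have h1 : Real.exp ε * (1 / (Real.exp ε + 1)) = Real.exp ε / (Real.exp ε + 1) := by ring
    have h2 : 1 / (Real.exp ε + 1) ≤ Real.exp ε / (Real.exp ε + 1) := by gcongr
    have h3 : Real.exp ε / (Real.exp ε + 1) ≤ Real.exp ε * (Real.exp ε / (Real.exp ε + 1)) :=
      le_mul_of_one_le_left (by positivity) he
    split_ifs <;> linarith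
  refine .of_expect fun f _ => ?_
  rw [ENNReal.ofReal_zero, add_zero, expect, expect, ← ENNReal.tsum_mul_left]
  refine ENNReal.tsum_le_tsum fun z => ?_
  rw [← mul_assoc]
  gcongr
  exact h z

section Run

variable {n : ℕ} {i j : Fin n}

theorem card_others (hij : i ≠ j) : Fintype.card (Others i j) = n - 2 := by
  have h : (Finset.univ.filter fun k : Fin n => k ≠ i ∧ k ≠ j) = ({i, j} : Finset (Fin n))ᶜ := by
    ext k
    simp
  rw [Fintype.card_subtype, h, Finset.card_compl, Finset.card_pair hij, Fintype.card_fin]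

/-- Wedge shuffling is private when a single wedge indicator changes. -/
theorem dpLe_ws {A A' : AdjMatrix n} {ε δ εL : ℝ} (hε : 0 ≤ ε) (hεL : 0 ≤ εL)
    (hN : NumericalBound (n - 2) εL hεL ε δ) (hij : i ≠ j) (k₀ : Others i j)
    (h : ∀ k : Others i j, k ≠ k₀ → (A' k i && A' k j) = (A k i && A k j)) :
    DPLe ε δ (ws A εL i j) (ws A' εL i j) := by
  refine .of_expect fun f hf => ?_
  rw [← card_others hij] at hN
  simp only [ws, expect_bind, expect_map]
  refine expect_rr_le_of_numericalBound (x := fun k : Others i j => A k i && A k j)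
    (x' := fun k : Others i j => A' k i && A' k j) hε hεL hN k₀ h
    (fun y => expect_le_one _ fun π => hf _) fun π₀ y => ?_
  simp only [expect_fintype, PMF.uniformOfFintype_apply]
  exact Equiv.sum_comp (Equiv.mulLeft π₀) fun π : Equiv.Perm (Others i j) =>
    (Fintype.card (Equiv.Perm (Others i j)) : ℝ≥0∞)⁻¹ * f fun k => y (π k)

/-- A run on `(i, j)` only reads the columns `i` and `j`. -/
theorem wsleMessage_congr {A A' : AdjMatrix n} (ε εL : ℝ) (hi : ∀ k, A k i = A' k i)
    (hj : ∀ k, A k j = A' k j) : wsleMessage A ε εL i j = wsleMessage A' ε εL i j := by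
  simp only [wsleMessage, ws, hi, hj]

theorem DPLe.wsleMessage_of_ws {A A' : AdjMatrix n} {ε ε' δ εL : ℝ}
    (h : DPLe ε' δ (ws A εL i j) (ws A' εL i j)) (hi : A i j = A' i j) (hj : A j i = A' j i) :
    DPLe ε' δ (wsleMessage A ε εL i j) (wsleMessage A' ε εL i j) := by
  rw [wsleMessage, wsleMessage, hi, hj]
  exact h.bind_right _

theorem dpLe_wsleMessage_left {A A' : AdjMatrix n} {ε εL : ℝ} (hε : 0 ≤ ε)
    (h : ws A εL i j = ws A' εL i j) (hj : A j i = A' j i) :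
    DPLe ε 0 (wsleMessage A ε εL i j) (wsleMessage A' ε εL i j) := by
  rw [wsleMessage, wsleMessage, h, hj]
  exact .bind_left _ fun y => (dpLe_rr hε _ _).bind_right _

theorem dpLe_wsleMessage_right {A A' : AdjMatrix n} {ε εL : ℝ} (hε : 0 ≤ ε)
    (h : ws A εL i j = ws A' εL i j) (hi : A i j = A' i j) :
    DPLe ε 0 (wsleMessage A ε εL i j) (wsleMessage A' ε εL i j) := by
  rw [wsleMessage, wsleMessage, h, hi]
  exact .bind_left _ fun y => .bind_left _ fun zi => (dpLe_rr hε _ _).map _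

theorem dpLe_wsleMessage_both {A A' : AdjMatrix n} {ε εL : ℝ} (hε : 0 ≤ ε)
    (h : ws A εL i j = ws A' εL i j) :
    DPLe (ε + ε) 0 (wsleMessage A ε εL i j) (wsleMessage A' ε εL i j) := by
  rw [wsleMessage, wsleMessage, h]
  refine .bind_left _ fun y => .trans_pure ((dpLe_rr hε _ (A' i j)).bind_right _) ?_
  exact .bind_left _ fun zi => (dpLe_rr hε _ _).map _

/-- The indicator of `b ∈ {i, j}`. -/
def inPair (b i j : Fin n) : ℝ := if b = i ∨ b = j then 1 else 0

/-- If the bit `(a, b)` changes, a run is affected only when its pair contains `b`. If the pair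
contains `a` too, only a noisy edge indicator changes, and otherwise only the wedge indicator
reported by `a`. -/
theorem dpLe_wsleMessage_element {A A' : AdjMatrix n} {ε δ εL : ℝ} (hε : 0 ≤ ε) (hδ : 0 ≤ δ)
    (hεL : 0 ≤ εL) (hN : NumericalBound (n - 2) εL hεL ε δ) (hij : i ≠ j) (a b : Fin n)
    (h : ∀ k l, (k, l) ≠ (a, b) → A k l = A' k l) :
    DPLe (ε * inPair b i j) (δ * inPair b i j) (wsleMessage A ε εL i j)
      (wsleMessage A' ε εL i j) := by
  by_cases hb : b = i ∨ b = j
  · rw [inPair, if_pos hb, mul_one, mul_one]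
    by_cases ha : a = i ∨ a = j
    · have hws : ws A εL i j = ws A' εL i j := by
        have : ∀ (k : Others i j) l, A k l = A' k l := by
          rintro ⟨k, hki, hkj⟩ l
          refine h k l fun hkl => ?_
          rw [(Prod.mk.inj hkl).1] at hki hkj
          exact ha.elim hki hkj
        simp only [ws, this]
      by_cases hai : a = i
      · refine (dpLe_wsleMessage_left hε hws (h j i fun hji => ?_)).mono le_rfl hδ
        exact hij (hai ▸ (Prod.mk.inj hji).1).symm
      · refine (dpLe_wsleMessage_right hε hws (h i j fun hji => ?_)).mono le_rfl hδ
        exact hai (Prod.mk.inj hji).1.symm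
    · refine DPLe.wsleMessage_of_ws (dpLe_ws hε hεL hN hij ⟨a, not_or.1 ha⟩ fun k hk => ?_)
        (h i j fun hij' => ha (.inl (Prod.mk.inj hij').1.symm))
        (h j i fun hji' => ha (.inr (Prod.mk.inj hji').1.symm))
      have : ∀ l, A k l = A' k l := fun l => h k l fun hkl => hk (Subtype.ext (Prod.mk.inj hkl).1)
      rw [this, this]
  · rw [inPair, if_neg hb, mul_zero, mul_zero, wsleMessage_congr ε εL
      (fun k => h k i fun hk => hb (.inl (Prod.mk.inj hk).2.symm))
      (fun k => h k j fun hk => hb (.inr (Prod.mk.inj hk).2.symm))]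
    exact .refl _

/-- If the bits `(a, b)` and `(b, a)` change, a run whose pair contains just one of `a` and `b`
reads just one of the two bits, and a run on the pair `{a, b}` reads them only for the noisy edge
indicators. -/
theorem dpLe_wsleMessage_edge {A A' : AdjMatrix n} {ε δ εL : ℝ} (hε : 0 ≤ ε) (hδ : 0 ≤ δ)
    (hεL : 0 ≤ εL) (hN : NumericalBound (n - 2) εL hεL ε δ) (hij : i ≠ j) (a b : Fin n)
    (h : ∀ k l, (k, l) ≠ (a, b) → (k, l) ≠ (b, a) → A k l = A' k l) :
    DPLe (ε * (inPair a i j + inPair b i j)) (δ * (inPair a i j + inPair b i j))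
      (wsleMessage A ε εL i j) (wsleMessage A' ε εL i j) := by
  have one : ∀ a b : Fin n, (∀ k l, (k, l) ≠ (a, b) → (k, l) ≠ (b, a) → A k l = A' k l) →
      ¬(b = i ∨ b = j) → DPLe (ε * inPair a i j) (δ * inPair a i j)
        (wsleMessage A ε εL i j) (wsleMessage A' ε εL i j) := by
    intro a b h hb
    -- the matrix that is already modified in the column `b`, which the run does not read
    set B : AdjMatrix n := fun k l => if l = b then A' k l else A k l
    have hB : ∀ k l, l = i ∨ l = j → B k l = A k l := by
      intro k l hl
      have hlb : l ≠ b := fun hlb => hb (hlb ▸ hl)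
      exact if_neg hlb
    rw [← wsleMessage_congr ε εL (fun k => hB k i (.inl rfl)) fun k => hB k j (.inr rfl)]
    refine dpLe_wsleMessage_element hε hδ hεL hN hij b a fun k l hkl => ?_
    by_cases hl : l = b
    · exact if_pos hl
    · refine (if_neg hl).trans (h k l (fun hk => hl (Prod.mk.inj hk).2) hkl)
  by_cases hb : b = i ∨ b = j
  · by_cases ha : a = i ∨ a = j
    · have hws : ws A εL i j = ws A' εL i j := by
        have : ∀ (k : Others i j) l, A k l = A' k l := by
          rintro ⟨k, hki, hkj⟩ l
          refine h k l (fun hkl => ?_) fun hkl => ?_ <;> rw [(Prod.mk.inj hkl).1] at hki hkj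
          · exact ha.elim hki hkj
          · exact hb.elim hki hkj
        simp only [ws, this]
      rw [inPair, if_pos ha, inPair, if_pos hb]
      exact (dpLe_wsleMessage_both hε hws).mono (by linarith) (by linarith)
    · have := one b a (fun k l h1 h2 => h k l h2 h1) ha
      rwa [inPair, if_neg ha, zero_add]
  · have := one a b h hb
    rwa [show inPair b i j = 0 from if_neg hb, add_zero]

end Run

/-! ### Privacy of the view -/

section View

variable {n t : ℕ} (ht : t ≤ n / 2)

theorem fstUser_ne_sndUser (σ : Equiv.Perm (Fin n)) (s : Fin t) :
    fstUser ht σ s ≠ sndUser ht σ s := by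
  intro h
  have := congrArg Fin.val (σ.injective h)
  simp at this

/-- The pairs are disjoint, so that a user belongs to at most one of them. -/
theorem sum_inPair_le_one (σ : Equiv.Perm (Fin n)) (b : Fin n) :
    ∑ s, inPair b (fstUser ht σ s) (sndUser ht σ s) ≤ 1 := by
  simp only [inPair, Finset.sum_boole]
  norm_cast
  refine Finset.card_le_one.2 fun s hs s' hs' => ?_
  have h : ∀ s : Fin t, b = fstUser ht σ s ∨ b = sndUser ht σ s →
      ((σ.symm b : Fin n) : ℕ) / 2 = s := by
    rintro s (rfl | rfl)
    · simp [fstUser]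
    · simp only [sndUser, Equiv.symm_apply_apply]
      omega
  exact Fin.ext ((h s (Finset.mem_filter.1 hs).2).symm.trans (h s' (Finset.mem_filter.1 hs').2))

/-- The runs compose: their privacy losses add up, for every choice of the pairs. -/
theorem dpLe_wShuffleView {A A' : AdjMatrix n} {ε ε' δ' εL : ℝ}
    (c d : Equiv.Perm (Fin n) → Fin t → ℝ) (hd : ∀ σ s, 0 ≤ d σ s)
    (hc : ∀ σ, ∑ s, c σ s ≤ ε') (hd' : ∀ σ, ∑ s, d σ s ≤ δ')
    (h : ∀ σ s, DPLe (c σ s) (d σ s) (wsleMessage A ε εL (fstUser ht σ s) (sndUser ht σ s))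
      (wsleMessage A' ε εL (fstUser ht σ s) (sndUser ht σ s))) :
    DPLe ε' δ' (wShuffleView ht ε εL A) (wShuffleView ht ε εL A') :=
  .bind_left _ fun σ =>
    ((DPLe.indep (c σ) (d σ) (hd σ) (h σ)).mono (hc σ) (hd' σ)).map _

theorem inPair_nonneg (b i j : Fin n) : 0 ≤ inPair b i j := by
  rw [inPair]
  split_ifs <;> norm_num

theorem elementDP_wShuffleView {ε δ εL : ℝ} (hε : 0 ≤ ε) (hδ : 0 ≤ δ) (hεL : 0 ≤ εL)
    (hN : NumericalBound (n - 2) εL hεL ε δ) :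
    ElementDP (wShuffleView (n := n) ht ε εL) ε δ := by
  rintro A A' ⟨⟨a, b⟩, -, hab⟩
  refine dpLe_wShuffleView ht
    (fun σ s => ε * inPair b (fstUser ht σ s) (sndUser ht σ s))
    (fun σ s => δ * inPair b (fstUser ht σ s) (sndUser ht σ s))
    (fun σ s => mul_nonneg hδ (inPair_nonneg _ _ _)) (fun σ => ?_) (fun σ => ?_) fun σ s => ?_
  · rw [← Finset.mul_sum]
    exact mul_le_of_le_one_right hε (sum_inPair_le_one ht σ b)
  · rw [← Finset.mul_sum]
    exact mul_le_of_le_one_right hδ (sum_inPair_le_one ht σ b)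
  · refine dpLe_wsleMessage_element hε hδ hεL hN (fstUser_ne_sndUser ht σ s) a b
      fun k l hkl => ?_
    by_contra hne
    exact hkl (hab (k, l) hne)

theorem edgeDP_wShuffleView {ε δ εL : ℝ} (hε : 0 ≤ ε) (hδ : 0 ≤ δ) (hεL : 0 ≤ εL)
    (hN : NumericalBound (n - 2) εL hεL ε δ) :
    EdgeDP (fun G : SimpleGraph (Fin n) => wShuffleView ht ε εL (adj G)) (2 * ε) (2 * δ) := by
  rintro G G' ⟨e, he⟩
  induction e using Sym2.ind with | _ a b => ?_
  have hsum : ∀ σ, ∑ s, (inPair a (fstUser ht σ s) (sndUser ht σ s)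
      + inPair b (fstUser ht σ s) (sndUser ht σ s)) ≤ 2 := by
    intro σ
    rw [Finset.sum_add_distrib]
    linarith [sum_inPair_le_one ht σ a, sum_inPair_le_one ht σ b]
  refine dpLe_wShuffleView ht
    (fun σ s => ε * (inPair a (fstUser ht σ s) (sndUser ht σ s)
      + inPair b (fstUser ht σ s) (sndUser ht σ s)))
    (fun σ s => δ * (inPair a (fstUser ht σ s) (sndUser ht σ s)
      + inPair b (fstUser ht σ s) (sndUser ht σ s)))
    (fun σ s => mul_nonneg hδ (add_nonneg (inPair_nonneg _ _ _) (inPair_nonneg _ _ _)))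
    (fun σ => ?_) (fun σ => ?_) fun σ s => ?_
  · rw [← Finset.mul_sum, mul_comm]
    exact mul_le_mul_of_nonneg_right (hsum σ) hε
  · rw [← Finset.mul_sum, mul_comm]
    exact mul_le_mul_of_nonneg_right (hsum σ) hδ
  · refine dpLe_wsleMessage_edge hε hδ hεL hN (fstUser_ne_sndUser ht σ s) a b
      fun k l h1 h2 => ?_
    have hkl : s(k, l) ∉ symmDiff G.edgeSet G'.edgeSet := by
      rw [he, Set.mem_singleton_iff, Sym2.eq_iff]
      rintro (⟨rfl, rfl⟩ | ⟨rfl, rfl⟩)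
      · exact h1 rfl
      · exact h2 rfl
    rw [Set.mem_symmDiff, SimpleGraph.mem_edgeSet, SimpleGraph.mem_edgeSet] at hkl
    have : G.Adj k l ↔ G'.Adj k l := by tauto
    exact decide_eq_decide.2 this

end View

theorem IsLocalPrivacyBudget.exists_numericalBound {n : ℕ} {ε δ εL : ℝ} (hδ : δ ≤ 1)
    (h : IsLocalPrivacyBudget n ε δ εL) :
    ∃ hεL : 0 ≤ εL, NumericalBound (n - 2) εL hεL ε δ := by
  obtain ⟨hn, hεL, hc | hN⟩ := h
  · exact ⟨hεL, numericalBound_of_closedFormBound (by omega) hεL hδ hc⟩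
  · exact ⟨hεL, hN⟩

end WedgeShuffle

theorem mainTheorem5 (n t : ℕ) (_ht1 : 1 ≤ t) (ht : t ≤ n / 2) (ε δ εL : ℝ)
    (_hε : 0 ≤ ε) (_hδ : δ ∈ Set.Icc (0 : ℝ) 1) (_hεL : IsLocalPrivacyBudget n ε δ εL) :
    ElementDP (wShuffle (n := n) ht ε εL) ε δ ∧
    EdgeDP (fun G : SimpleGraph (Fin n) => wShuffle ht ε εL (adj G)) (2 * ε) (2 * δ) ∧
    ElementDP (wShuffleView (n := n) ht ε εL) ε δ ∧
    EdgeDP (fun G : SimpleGraph (Fin n) => wShuffleView ht ε εL (adj G)) (2 * ε) (2 * δ) := by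
  obtain ⟨hεL, hN⟩ := _hεL.exists_numericalBound _hδ.2
  have h1 := elementDP_wShuffleView ht _hε _hδ.1 hεL hN
  have h2 := edgeDP_wShuffleView ht _hε _hδ.1 hεL hN
  exact ⟨fun A A' h => (h1 A A' h).map _, fun G G' h => (h2 G G' h).map _, h1, h2⟩
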